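/- Let $n\ge 1$, $b>0$, $m\in\mathbb R$ with $b^2\ge 4m^2$, let $R>0$, and let $p,q>1$ satisfy $$\theta=\theta(n,p,q):=\frac{1}{pq-1}-\frac{n-1}{2}\ \ge 0 .$$ Let $u_0,v_0\in C^2(\mathbb R^n)$ and $u_1,v_1\in C^1(\mathbb R^n)$ be nonnegative with supports contained in the closed ball $B_R$ of radius $R$ about the origin, and let $v_1\not\equiv 0$. For $\varepsilon>0$ consider the Cauchy problem $$\begin{cases}\partial_t^2u-\Delta u+b\,\partial_tu+m^2u=|\partial_tv|^p, & x\in\mathbb R^n,\ t\in(0,T),\\ \partial_t^2v-\Delta v=|\partial_tu|^q, & x\in\mathbb R^n,\ t\in(0,T),\\ (u,\partial_tu)(0,\cdot)=\varepsilon(u_0,u_1),\quad (v,\partial_tv)(0,\cdot)=\varepsilon(v_0,v_1).\end{cases}$$ For $T\in(0,\infty]$, a solution on $[0,T)$ is a pair $u,v\in C([0,T)\times\mathbb R^n)$ with $u(0,\cdot)=\varepsilon u_0$, $v(0,\cdot)=\varepsilon v_0$, having weak time derivatives with $\partial_tu,\partial_tv,|\partial_tu|^q,|\partial_tv|^p\in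 L^1_{\mathrm{loc}}([0,T)\times\mathbb R^n)$, such that for every $\varphi\in C_c^\infty([0,T)\times\mathbb R^n)$ $$\int_0^T\!\!\int_{\mathbb R^n}u\,(\partial_t^2\varphi-\Delta\varphi-b\,\partial_t\varphi+m^2\varphi)\,dx\,dt=\int_0^T\!\!\int_{\mathbb R^n}|\partial_tv|^p\varphi\,dx\,dt+\varepsilon\int_{\mathbb R^n}\big((u_1+bu_0)\varphi(0,\cdot)-u_0\,\partial_t\varphi(0,\cdot)\big)dx,$$ $$\int_0^T\!\!\int_{\mathbb R^n}v\,(\partial_t^2\varphi-\Delta\varphi)\,dx\,dt=\int_0^T\!\!\int_{\mathbb R^n}|\partial_tu|^q\varphi\,dx\,dt+\varepsilon\int_{\mathbb R^n}\big(v_1\varphi(0,\cdot)-v_0\,\partial_t\varphi(0,\cdot)\big)dx.$$ (In particular, every classical solution is a solution.) Then there exist constants $\varepsilon_0>0$ and $C>0$, depending only on $n,p,q,b,R,v_1$, such that for every $\varepsilon\in(0,\varepsilon_0]$, every $T\in(0,\infty]$ and every solution $(u,v)$ on $[0,T)$ with $$\operatorname{supp}u(t,\cdot),\ \operatorname{supp}v(t,\cdot)\subset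 B_{R+t}\qquad\text{for all }t\in[0,T),$$ one has $T<\infty$, and moreover $$T\le\begin{cases}C\,\varepsilon^{-1/\theta} & \text{if }\theta>0,\\ \exp\!\big(C\,\varepsilon^{-(pq-1)}\big) & \text{if }\theta=0.\end{cases}$$ That is, $(u,v)$ blows up in finite time and its lifespan $T(\varepsilon)$ obeys this upper bound. -/

import Mathlib

open MeasureTheory Set
open scoped ContDiff

noncomputable section

namespace Nakao

/-- The Euclidean space `ℝⁿ`. -/
abbrev Space (n : ℕ) : Type := EuclideanSpace ℝ (Fin n)

/-- The space-time slab `[0, T) × ℝⁿ`, where `T = ⊤` is allowed. -/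
def slab (n : ℕ) (T : EReal) : Set (ℝ × Space n) :=
  {z | 0 ≤ z.1 ∧ (z.1 : EReal) < T}

/-- The classical time derivative `∂ₜφ` (used for smooth test functions only). -/
def timeDeriv {n : ℕ} (φ : ℝ × Space n → ℝ) (z : ℝ × Space n) : ℝ :=
  deriv (fun s : ℝ => φ (s, z.2)) z.1

/-- The Laplacian `Δφ` in the space variables (used for smooth test functions only). -/
def spaceLaplacian {n : ℕ} (φ : ℝ × Space n → ℝ) (z : ℝ × Space n) : ℝ :=
  Laplacian.laplacian (fun y : Space n => φ (z.1, y)) z.2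

/-- Test functions on `[0, T) × ℝⁿ`: restrictions of smooth functions whose support is a compact
subset of `(-∞, T) × ℝⁿ`. They need not vanish at `t = 0`. -/
structure IsTestFunction (n : ℕ) (T : EReal) (φ : ℝ × Space n → ℝ) : Prop where
  smooth : ContDiff ℝ ∞ φ
  compact : HasCompactSupport φ
  supp : tsupport φ ⊆ {z | (z.1 : EReal) < T}

/-- `w` is the weak time derivative of `u` in `(0, T) × ℝⁿ`, and `w ∈ L¹_loc([0, T) × ℝⁿ)`. -/
structure HasWeakTimeDeriv (n : ℕ) (T : EReal) (u w : ℝ × Space n → ℝ) : Prop where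
  locallyIntegrable : LocallyIntegrableOn w (slab n T)
  integral_eq : ∀ φ : ℝ × Space n → ℝ, IsTestFunction n T φ → tsupport φ ⊆ {z | 0 < z.1} →
    ∫ z in slab n T, u z * timeDeriv φ z = -∫ z in slab n T, w z * φ z

/-- The distributional form of the Cauchy problem
`∂ₜ²u - Δu + b ∂ₜu + c u = F` in `(0, T) × ℝⁿ`, `u(0, ·) = f`, `∂ₜu(0, ·) = g`. -/
def SolvesWeakly (n : ℕ) (T : EReal) (b c : ℝ) (F : ℝ × Space n → ℝ) (f g : Space n → ℝ)
    (u : ℝ × Space n → ℝ) : Prop :=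
  ∀ φ : ℝ × Space n → ℝ, IsTestFunction n T φ →
    ∫ z in slab n T,
        u z * (timeDeriv (timeDeriv φ) z - spaceLaplacian φ z - b * timeDeriv φ z + c * φ z) =
      (∫ z in slab n T, F z * φ z) +
        ∫ x : Space n, ((g x + b * f x) * φ (0, x) - f x * timeDeriv φ (0, x))

/-- `(u, v)` is a (weak, continuous) solution on `[0, T) × ℝⁿ` of
`∂ₜ²u - Δu + b ∂ₜu + m² u = |∂ₜv|ᵖ`, `∂ₜ²v - Δv = |∂ₜu|^q` with
`(u, ∂ₜu)(0, ·) = (f₀, f₁)` and `(v, ∂ₜv)(0, ·) = (g₀, g₁)`. The functions `ut`, `vt` are the weak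
time derivatives; the nonlinear terms are locally integrable up to `t = 0`. -/
structure IsSolution (n : ℕ) (b m p q : ℝ) (f₀ f₁ g₀ g₁ : Space n → ℝ) (T : EReal)
    (u v : ℝ × Space n → ℝ) : Prop where
  continuous_u : ContinuousOn u (slab n T)
  continuous_v : ContinuousOn v (slab n T)
  initial_u : ∀ x, u (0, x) = f₀ x
  initial_v : ∀ x, v (0, x) = g₀ x
  system : ∃ ut vt : ℝ × Space n → ℝ,
    HasWeakTimeDeriv n T u ut ∧ HasWeakTimeDeriv n T v vt ∧
    LocallyIntegrableOn (fun z => |ut z| ^ q) (slab n T) ∧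
    LocallyIntegrableOn (fun z => |vt z| ^ p) (slab n T) ∧
    SolvesWeakly n T b (m ^ 2) (fun z => |vt z| ^ p) f₀ f₁ u ∧
    SolvesWeakly n T 0 0 (fun z => |ut z| ^ q) g₀ g₁ v

/-- `supp u(t, ·) ⊆ B_{R + t}` for all `t ∈ [0, T)`. -/
def SupportedInCone (n : ℕ) (R : ℝ) (T : EReal) (u : ℝ × Space n → ℝ) : Prop :=
  ∀ t : ℝ, 0 ≤ t → (t : EReal) < T →
    tsupport (fun x : Space n => u (t, x)) ⊆ Metric.closedBall 0 (R + t)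

/-- The exponent `θ(n, p, q) = 1 / (pq - 1) - (n - 1) / 2`. -/
def theta (n : ℕ) (p q : ℝ) : ℝ := 1 / (p * q - 1) - ((n : ℝ) - 1) / 2

end Nakao

end

/-! Both equations are tested against the same plane exponential Φ(x) = e^{b x_a}, for which ΔΦ =
b²Φ. The means of u and v against Φ then solve, in the distributional sense, U'' + bU' + (m² − b²)U
= M and V'' − b²V = N, where M and N are the means of |∂ₜv|^p and |∂ₜu|^q. Solving these ODEs by
their characteristic roots (`ae_eq_of_weak_ode`) and discarding nonnegative terms gives V' ≥ e^{bt}H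
with H(t) = (J + ∫₀ᵗ e^{−bs}N ds)/2, J being the Φ-mean of the initial velocity of v, and U' ≥ ∫₀ᵗ
e^{−2b(t−s)}M ds. The assumption 4m² ≤ b² makes the roots real and gives every discarded term the
right sign.

The cone condition closes the loop: the Φ-mass of B_{R+t} is O(e^{bt}(R+t)^{(n−1)/2})
(`exists_setIntegral_exp_le`), so Jensen's inequality bounds M below by a power of V' and N below by
a power of U' (`HasWeakTimeDeriv.ae_rpow_le_expMean`). The exponential factors cancel. Keeping only
the last stretch of length τ in the convolution leads to H(t₁) ≥ H(t₀) + c τ^q H(t₀)^{pq}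
∫_{t₀+τ}^{t₁} (R+t)^{−κ} dt, κ = (n−1)(pq−1)/2, and θ ≥ 0 says exactly that κ ≤ 1
(`add_rpow_mul_log_le`).

The delay τ is harmless: with geometrically decreasing delays H doubles on each of a sequence of
slices whose lengths in log t are summable, so H is unbounded before a finite time
(`lt_of_log_slicing`). This leaves two free parameters, a starting time T₀ and a logarithmic length
L. For θ > 0 the smallness of ε is absorbed by T₀, for θ = 0 by L, whence the two forms of the
lifespan bound. -/

namespace Nakao

/-! ### Blow-up for an integral inequality with shrinking delays -/

/-- The times `t_{j+1} = (t_j + τ_j) exp (L τ_j)` with `τ_j = ρ ^ j` at which a solution of the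
integral inequality in `lt_of_log_slicing` doubles. -/
noncomputable def sliceTime (T₀ L ρ : ℝ) : ℕ → ℝ
  | 0 => T₀
  | j + 1 => (sliceTime T₀ L ρ j + ρ ^ j) * Real.exp (L * ρ ^ j)

/-- Since all times and L are at least 1, the additive delay ρ^j costs no more than another factor
e^{Lρ^j}; this is the 2 in the exponent. For ρ < 1 the times therefore stay bounded. -/
theorem sliceTime_bounds {T₀ L ρ : ℝ} (hT₀ : 1 ≤ T₀) (hL : 1 ≤ L) (hρ : 0 < ρ) (j : ℕ) :
    T₀ ≤ sliceTime T₀ L ρ j ∧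
      sliceTime T₀ L ρ j ≤ T₀ * Real.exp (2 * L * ∑ i ∈ Finset.range j, ρ ^ i) := by
  induction j with
  | zero => simp [sliceTime]
  | succ j ih =>
    obtain ⟨h1, h2⟩ := ih
    have hρj : 0 < ρ ^ j := pow_pos hρ j
    have hLρ : 0 < L * ρ ^ j := by positivity
    constructor
    · rw [sliceTime]
      have : 1 ≤ Real.exp (L * ρ ^ j) := Real.one_le_exp hLρ.le
      nlinarith
    · rw [sliceTime, Finset.sum_range_succ]
      have e1 : sliceTime T₀ L ρ j + ρ ^ j ≤ sliceTime T₀ L ρ j * Real.exp (L * ρ ^ j) := by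
        have h3 : 1 + ρ ^ j ≤ Real.exp (L * ρ ^ j) := by
          have := Real.add_one_le_exp (L * ρ ^ j)
          nlinarith
        have h4 : (1:ℝ) ≤ sliceTime T₀ L ρ j := hT₀.trans h1
        nlinarith
      calc (sliceTime T₀ L ρ j + ρ ^ j) * Real.exp (L * ρ ^ j)
          ≤ (sliceTime T₀ L ρ j * Real.exp (L * ρ ^ j)) * Real.exp (L * ρ ^ j) := by gcongr
        _ ≤ (T₀ * Real.exp (2 * L * ∑ i ∈ Finset.range j, ρ ^ i) * Real.exp (L * ρ ^ j)) *
              Real.exp (L * ρ ^ j) := by gcongr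
        _ = _ := by
          rw [mul_assoc, mul_assoc, ← Real.exp_add, ← Real.exp_add]
          congr 2; ring

/-- Blow-up for a nonlinear integral inequality with a vanishing delay `τ`, by slicing in the
logarithmic time scale. -/
theorem lt_of_log_slicing {P q c A h₀ T₀ L B : ℝ} {H : ℝ → ℝ} (hP : 1 < P) (hq : 1 < q)
    (hc : 0 < c) (hA : 0 < A) (hh₀ : 0 < h₀) (hT₀ : 1 ≤ T₀) (hL : 1 ≤ L)
    (hmono : MonotoneOn H (Icc T₀ B)) (h0 : T₀ ≤ B → h₀ ≤ H T₀)
    (hH : ∀ t₀ t₁ τ : ℝ, T₀ ≤ t₀ → 0 < τ → τ ≤ 1 → t₀ + τ ≤ t₁ → t₁ ≤ B →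
      H t₀ + c * τ ^ q * H t₀ ^ P * A * Real.log (t₁ / (t₀ + τ)) ≤ H t₁)
    (hcond : 1 ≤ c * L * A * h₀ ^ (P - 1)) :
    B < T₀ * Real.exp (2 * L * (1 - (2 : ℝ) ^ (-((P - 1) / (q + 1))))⁻¹) := by
  -- The ratio satisfies ρ^{q+1} · 2^{P−1} = 1: the loss τ^q from the delay and the loss from the
  -- shorter logarithmic slice are balanced by the superlinear gain from doubling.
  set ρ : ℝ := (2 : ℝ) ^ (-((P - 1) / (q + 1))) with hρdef
  have hρ : 0 < ρ := by positivity
  have hμ : 0 < (P - 1) / (q + 1) := div_pos (by linarith) (by linarith)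
  have hρ1 : ρ < 1 := Real.rpow_lt_one_of_one_lt_of_neg (by norm_num) (by linarith)
  by_contra! hB
  have hsum : ∀ j, ∑ i ∈ Finset.range j, ρ ^ i ≤ (1 - ρ)⁻¹ := fun j => by
    rw [← tsum_geometric_of_lt_one hρ.le hρ1]
    exact (summable_geometric_of_lt_one hρ.le hρ1).sum_le_tsum _ (fun i _ => by positivity)
  have htB : ∀ j, sliceTime T₀ L ρ j ≤ B := fun j => by
    refine (sliceTime_bounds hT₀ hL hρ j).2.trans (le_trans ?_ hB)
    have := hsum j
    gcongr
  have hT₀B : T₀ ≤ B := htB 0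
  have hgrow : ∀ j : ℕ, 2 ^ j * h₀ ≤ H (sliceTime T₀ L ρ j) := by
    intro j
    induction j with
    | zero => simpa [sliceTime] using h0 hT₀B
    | succ j ih =>
      obtain ⟨hs, -⟩ := sliceTime_bounds hT₀ hL hρ j
      set s := sliceTime T₀ L ρ j with hsdef
      have hρj : 0 < ρ ^ j := pow_pos hρ j
      have hτ1 : ρ ^ j ≤ 1 := pow_le_one₀ hρ.le hρ1.le
      have hexp : 1 ≤ Real.exp (L * ρ ^ j) := Real.one_le_exp (by positivity)
      have hsρ : 0 < s + ρ ^ j := by linarith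
      have key := hH s (sliceTime T₀ L ρ (j + 1)) (ρ ^ j) hs hρj hτ1
        (by rw [sliceTime]; nlinarith) (htB _)
      have hlog : Real.log (sliceTime T₀ L ρ (j + 1) / (s + ρ ^ j)) = L * ρ ^ j := by
        rw [sliceTime, mul_div_assoc, mul_comm, div_mul_cancel₀ _ hsρ.ne', Real.log_exp]
      rw [hlog] at key
      have h2j : (0:ℝ) < 2 ^ j * h₀ := by positivity
      have hpow : (ρ ^ j) ^ q * (ρ ^ j) * (2 ^ j * h₀) ^ P = 2 ^ j * h₀ * h₀ ^ (P - 1) := by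
        have e1 : (ρ ^ j) ^ q * (ρ ^ j) = ((2:ℝ) ^ j) ^ (-(P - 1)) := by
          rw [← Real.rpow_add_one hρj.ne', hρdef, ← Real.rpow_natCast, ← Real.rpow_natCast,
            ← Real.rpow_mul (by positivity), ← Real.rpow_mul (by positivity),
            ← Real.rpow_mul (by positivity)]
          congr 1
          field_simp
        have e2 : (2 ^ j * h₀) ^ P = (2 ^ j * h₀) ^ (P - 1) * (2 ^ j * h₀) := by
          rw [← Real.rpow_add_one h2j.ne']; congr 1; ring
        rw [e1, e2, Real.mul_rpow (by positivity) hh₀.le, Real.rpow_neg (by positivity)]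
        field_simp
      have hle : c * (ρ ^ j) ^ q * (2 ^ j * h₀) ^ P * A * (L * ρ ^ j) ≤
          c * (ρ ^ j) ^ q * H s ^ P * A * (L * ρ ^ j) := by gcongr
      -- All powers of j have cancelled except 2^j, so `hcond` makes the increment at least 2^j h₀,
      -- which is a doubling.
      have heq : c * (ρ ^ j) ^ q * (2 ^ j * h₀) ^ P * A * (L * ρ ^ j) =
          (2 ^ j * h₀) * (c * L * A * h₀ ^ (P - 1)) := by
        linear_combination (c * A * L) * hpow
      rw [pow_succ]
      nlinarith
  -- Every slice time is at most B, so the fixed number H(B) would bound all 2^j h₀.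
  obtain ⟨j, hj⟩ := pow_unbounded_of_one_lt (H B / h₀) (one_lt_two)
  have h1 : H (sliceTime T₀ L ρ j) ≤ H B :=
    hmono ⟨(sliceTime_bounds hT₀ hL hρ j).1, htB j⟩ ⟨hT₀B, le_rfl⟩ (htB j)
  rw [div_lt_iff₀ hh₀] at hj
  linarith [hgrow j]

/-! ### Mass of the plane exponential on a ball -/

/-- On the ball the transverse coordinates satisfy |x'|² ≤ 2r(r − x_a). Half of the deficit l(r −
x_a) is traded for a Gaussian of variance of order r in x', the other half stays as decay in x_a.
The majorant is a product, so it integrates by Fubini; each of the n − 1 Gaussians contributes √r.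
-/
theorem exp_le_prod_of_norm_le {n : ℕ} (a : Fin n) {l r : ℝ} (hl : 0 < l) (hr : 0 < r)
    {x : Space n} (hx : ‖x‖ ≤ r) :
    Real.exp (l * x a) ≤ Real.exp (l * r / 2) * ∏ i, (if i = a then
      (Iic r).indicator (fun s => Real.exp (l / 2 * s)) else
      fun s => Real.exp (-(l / (4 * r)) * s ^ 2)) (x i) := by
  have hsq : ∑ i, x i ^ 2 ≤ r ^ 2 := by
    have := EuclideanSpace.real_norm_sq_eq x
    rw [← this]
    gcongr
  have hsplit : ∑ i, x i ^ 2 = x a ^ 2 + ∑ i ∈ ({a} : Finset (Fin n))ᶜ, x i ^ 2 :=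
    Fintype.sum_eq_add_sum_compl a _
  have hpos : 0 ≤ ∑ i ∈ ({a} : Finset (Fin n))ᶜ, x i ^ 2 := Finset.sum_nonneg fun i _ => sq_nonneg _
  have hxa : |x a| ≤ r := abs_le_of_sq_le_sq (by linarith) hr.le
  have hxa' := (abs_le.1 hxa).2
  rw [Fintype.prod_eq_mul_prod_compl a, if_pos rfl, indicator_of_mem (by exact hxa')]
  have : ∏ i ∈ ({a} : Finset (Fin n))ᶜ, (if i = a then
      (Iic r).indicator (fun s => Real.exp (l / 2 * s)) else
      fun s => Real.exp (-(l / (4 * r)) * s ^ 2)) (x i) =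
      Real.exp (-(l / (4 * r)) * ∑ i ∈ ({a} : Finset (Fin n))ᶜ, x i ^ 2) := by
    rw [Finset.mul_sum, Real.exp_sum]
    refine Finset.prod_congr rfl fun i hi => ?_
    rw [if_neg (by simpa using hi)]
  rw [this, ← Real.exp_add, ← Real.exp_add, Real.exp_le_exp]
  -- The sum is at most r² − x_a² = (r − x_a)(r + x_a), and r + x_a ≤ 2r.
  have h1 : ∑ i ∈ ({a} : Finset (Fin n))ᶜ, x i ^ 2 ≤ 2 * r * (r - x a) := by nlinarith
  have h2 : l / (4 * r) * ∑ i ∈ ({a} : Finset (Fin n))ᶜ, x i ^ 2 ≤ l / 2 * (r - x a) := by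
    calc _ ≤ l / (4 * r) * (2 * r * (r - x a)) := by gcongr
      _ = _ := by field_simp; ring
  linarith

/-- The mass of the plane exponential on a ball of radius `r` is `O(e^{lr} r^{(n-1)/2})`. -/
theorem exists_setIntegral_exp_le {n : ℕ} (hn : 1 ≤ n) (a : Fin n) {l : ℝ} (hl : 0 < l) :
    ∃ C : ℝ, 0 < C ∧ ∀ r : ℝ, 0 < r →
      ∫ x in Metric.closedBall (0 : Space n) r, Real.exp (l * x a) ≤
        C * Real.exp (l * r) * r ^ (((n : ℝ) - 1) / 2) := by
  refine ⟨(2 / l) * √(4 * Real.pi / l) ^ (n - 1), by positivity, fun r hr => ?_⟩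
  set F : Fin n → ℝ → ℝ := fun i => if i = a then
      (Iic r).indicator (fun s => Real.exp (l / 2 * s)) else
      fun s => Real.exp (-(l / (4 * r)) * s ^ 2) with hF
  have hFi : ∀ i, Integrable (F i) := by
    intro i
    simp only [hF]
    split_ifs
    · rw [integrable_indicator_iff measurableSet_Iic]
      exact integrableOn_exp_mul_Iic (by positivity) r
    · exact integrable_exp_neg_mul_sq (by positivity)
  have hprod : Integrable (fun x : Space n => ∏ i, F i (x i)) :=
    (PiLp.volume_preserving_ofLp (Fin n)).integrable_comp_of_integrable
      (g := fun y : Fin n → ℝ => ∏ i, F i (y i)) (Integrable.fintype_prod hFi)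
  have hintegral : ∫ x : Space n, ∏ i, F i (x i) = ∏ i, ∫ s, F i s := by
    rw [← integral_fintype_prod_volume_eq_prod]
    exact (PiLp.volume_preserving_ofLp (Fin n)).integral_comp
      (MeasurableEquiv.toLp 2 (Fin n → ℝ)).symm.measurableEmbedding
      (fun y : Fin n → ℝ => ∏ i, F i (y i))
  have hnn : ∀ x : Space n, 0 ≤ ∏ i, F i (x i) := fun x => Finset.prod_nonneg fun i _ => by
    simp only [hF]
    split_ifs
    · exact indicator_nonneg (fun _ _ => (Real.exp_pos _).le) _
    · exact (Real.exp_pos _).le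
  have hFa : ∫ s, F a s = 2 / l * Real.exp (l * r / 2) := by
    simp only [hF, if_true]
    rw [integral_indicator measurableSet_Iic, integral_exp_mul_Iic (by positivity)]
    field_simp
  have hFo : ∏ i ∈ ({a} : Finset (Fin n))ᶜ, ∫ s, F i s =
      (√(4 * Real.pi / l) * √r) ^ (n - 1) := by
    rw [Finset.prod_congr rfl (g := fun _ => √(4 * Real.pi / l) * √r), Finset.prod_const,
      Finset.card_compl, Finset.card_singleton, Fintype.card_fin]
    intro i hi
    have : i ≠ a := by simpa using hi
    simp only [hF, if_neg this]
    rw [integral_gaussian, ← Real.sqrt_mul (by positivity)]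
    congr 1
    field_simp
  have hsqrt : √r ^ (n - 1) = r ^ (((n : ℝ) - 1) / 2) := by
    rw [Real.sqrt_eq_rpow, ← Real.rpow_natCast, ← Real.rpow_mul hr.le, Nat.cast_sub hn]
    congr 1; push_cast; ring
  calc ∫ x in Metric.closedBall (0 : Space n) r, Real.exp (l * x a)
      ≤ ∫ x in Metric.closedBall (0 : Space n) r, Real.exp (l * r / 2) * ∏ i, F i (x i) := by
        refine setIntegral_mono_on ?_ (hprod.const_mul _).integrableOn
          Metric.isClosed_closedBall.measurableSet fun x hx => ?_
        · exact (by fun_prop : Continuous fun x : Space n => Real.exp (l * x a)).continuousOn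
            |>.integrableOn_compact (isCompact_closedBall _ _)
        · exact exp_le_prod_of_norm_le a hl hr (by simpa using hx)
    _ ≤ ∫ x : Space n, Real.exp (l * r / 2) * ∏ i, F i (x i) :=
        setIntegral_le_integral (hprod.const_mul _)
          (Filter.Eventually.of_forall fun x => mul_nonneg (Real.exp_pos _).le (hnn x))
    _ = _ := by
        rw [integral_const_mul, hintegral, Fintype.prod_eq_mul_prod_compl a, hFa, hFo, mul_pow, hsqrt]
        have : Real.exp (l * r) = Real.exp (l * r / 2) * Real.exp (l * r / 2) := by
          rw [← Real.exp_add]; congr 1; ring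
        rw [this]; ring

/-! ### Linear second-order ODEs in the distributional sense -/

/-- The solution `e^{-αt} ∫_t^B e^{αs} η(s) ds` of the backward problem `E' = -αE - η`,
`E(B) = 0`. -/
noncomputable def expTail (α B : ℝ) (η : ℝ → ℝ) (t : ℝ) : ℝ :=
  Real.exp (-α * t) * ∫ s in t..B, Real.exp (α * s) * η s

/-- The solution `e^{αt} (J + ∫_0^t e^{-αs} N(s) ds)` of `Y' = αY + N`, `Y(0) = J`. -/
noncomputable def expPrimitive (α J : ℝ) (N : ℝ → ℝ) (t : ℝ) : ℝ :=
  Real.exp (α * t) * (J + ∫ s in (0 : ℝ)..t, Real.exp (-α * s) * N s)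

theorem hasDerivAt_expTail (α B : ℝ) {η : ℝ → ℝ} (hη : Continuous η) (t : ℝ) :
    HasDerivAt (expTail α B η) (-α * expTail α B η t - η t) t := by
  have hc : Continuous fun s => Real.exp (α * s) * η s := by fun_prop
  have h1 : HasDerivAt (fun t => ∫ s in t..B, Real.exp (α * s) * η s)
      (-(Real.exp (α * t) * η t)) t :=
    intervalIntegral.integral_hasDerivAt_left (hc.intervalIntegrable _ _)
      (hc.stronglyMeasurableAtFilter _ _) hc.continuousAt
  have h2 : HasDerivAt (fun t => Real.exp (-α * t)) (Real.exp (-α * t) * (-α * 1)) t :=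
    ((hasDerivAt_id t).const_mul (-α)).exp
  refine (h2.mul h1).congr_deriv ?_
  have : Real.exp (-α * t) * Real.exp (α * t) = 1 := by rw [← Real.exp_add]; simp
  simp only [expTail]
  linear_combination (-η t) * this

theorem contDiff_expTail (α B : ℝ) {η : ℝ → ℝ} (hη : ContDiff ℝ ∞ η) :
    ContDiff ℝ ∞ (expTail α B η) := by
  have hc : Continuous fun s => Real.exp (α * s) * η s := by
    have := hη.continuous; fun_prop
  have h1 : ∀ t, HasDerivAt (fun t => ∫ s in t..B, Real.exp (α * s) * η s)
      (-(Real.exp (α * t) * η t)) t := fun t =>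
    intervalIntegral.integral_hasDerivAt_left (hc.intervalIntegrable _ _)
      (hc.stronglyMeasurableAtFilter _ _) hc.continuousAt
  have h2 : ContDiff ℝ ∞ (fun t => ∫ s in t..B, Real.exp (α * s) * η s) := by
    rw [contDiff_infty_iff_deriv]
    refine ⟨fun t => (h1 t).differentiableAt, ?_⟩
    rw [funext fun t => (h1 t).deriv]
    fun_prop
  unfold expTail
  fun_prop

/-- Used with B' < B: the test function built from tails then vanishes in a neighbourhood of B, as
an admissible one must. -/
theorem expTail_eq_zero {α B B' : ℝ} {η : ℝ → ℝ} (hB : B' ≤ B) (hη : ∀ s, B' ≤ s → η s = 0)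
    {t : ℝ} (ht : B' ≤ t) : expTail α B η t = 0 := by
  rw [expTail, intervalIntegral.integral_congr (g := fun _ => 0)]
  · simp
  · intro s hs
    change Real.exp (α * s) * η s = 0
    rw [hη s ((le_min ht hB).trans hs.1), mul_zero]

/-- The operators `expTail` and `expPrimitive` are adjoint to each other. -/
theorem integral_mul_expTail {B : ℝ} (hB : 0 < B) (α J : ℝ) {N η : ℝ → ℝ}
    (hN : IntegrableOn N (Ioc 0 B)) (hη : Continuous η) :
    (∫ s in Ioc 0 B, N s * expTail α B η s) + J * expTail α B η 0 =
      ∫ t in Ioc 0 B, η t * expPrimitive α J N t := by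
  set g : ℝ → ℝ := fun t => Real.exp (α * t) * η t with hg
  set M : ℝ → ℝ := fun s => Real.exp (-α * s) * N s with hM
  have hgc : Continuous g := by fun_prop
  have hMi : IntegrableOn M (Ioc 0 B) := by
    have : IntegrableOn M (Icc 0 B) :=
      ((integrableOn_Icc_iff_integrableOn_Ioc).2 hN).continuousOn_mul
        (by fun_prop) isCompact_Icc
    exact this.mono_set Ioc_subset_Icc_self
  have hgi : IntegrableOn g (Ioc 0 B) :=
    (hgc.integrableOn_Icc).mono_set Ioc_subset_Icc_self
  -- The indicator encodes the triangle s < t in the square, on which Fubini is applied.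
  have hprod : Integrable (Function.uncurry fun s t => (Ioi s).indicator (fun t => M s * g t) t)
      ((volume.restrict (Ioc 0 B)).prod (volume.restrict (Ioc 0 B))) := by
    have h := (Integrable.mul_prod hMi hgi).indicator
      (measurableSet_lt measurable_fst measurable_snd : MeasurableSet {z : ℝ × ℝ | z.1 < z.2})
    refine h.congr (Filter.Eventually.of_forall fun z => ?_)
    simp [Function.uncurry, indicator]
  have hswap := integral_integral_swap hprod
  have hl : ∀ s ∈ Ioc 0 B, ∫ t in Ioc 0 B, (Ioi s).indicator (fun t => M s * g t) t =
      N s * expTail α B η s := by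
    intro s hs
    rw [setIntegral_indicator measurableSet_Ioi, integral_const_mul]
    have : Ioc 0 B ∩ Ioi s = Ioc s B := by
      ext t; simp only [mem_inter_iff, mem_Ioc, mem_Ioi]
      exact ⟨fun h => ⟨h.2, h.1.2⟩, fun h => ⟨⟨hs.1.trans h.1, h.2⟩, h.1⟩⟩
    rw [this, expTail, intervalIntegral.integral_of_le hs.2]
    ring
  have hr : ∀ t ∈ Ioc 0 B, ∫ s in Ioc 0 B, (Ioi s).indicator (fun t => M s * g t) t =
      g t * ∫ s in (0:ℝ)..t, M s := by
    intro t ht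
    have h1 : ∀ s, (Ioi s).indicator (fun t => M s * g t) t =
        (Iio t).indicator (fun s => g t * M s) s := by
      intro s; simp [indicator, mul_comm]
    simp only [h1]
    rw [setIntegral_indicator measurableSet_Iio, integral_const_mul,
      intervalIntegral.integral_of_le ht.1.le, integral_Ioc_eq_integral_Ioo]
    congr 3
    ext s; simp only [mem_inter_iff, mem_Ioc, mem_Iio, mem_Ioo]
    exact ⟨fun h => ⟨h.1.1, h.2⟩, fun h => ⟨⟨h.1, h.2.le.trans ht.2⟩, h.2⟩⟩
  rw [setIntegral_congr_fun measurableSet_Ioc hl, setIntegral_congr_fun measurableSet_Ioc hr]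
    at hswap
  have hcont : ContinuousOn (fun t => ∫ s in (0:ℝ)..t, M s) (Icc 0 B) := by
    have := intervalIntegral.continuousOn_primitive_interval (a := (0:ℝ)) (b := B) (f := M)
      (by rw [uIcc_of_le hB.le]; exact (integrableOn_Icc_iff_integrableOn_Ioc).2 hMi)
    rwa [uIcc_of_le hB.le] at this
  have hi2 : IntegrableOn (fun t => g t * ∫ s in (0:ℝ)..t, M s) (Ioc 0 B) :=
    ((hgc.continuousOn.mul hcont).integrableOn_Icc).mono_set Ioc_subset_Icc_self
  rw [hswap]
  have hE0 : expTail α B η 0 = ∫ t in Ioc 0 B, g t := by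
    rw [expTail, intervalIntegral.integral_of_le hB.le]; simp [hg]
  rw [hE0, ← integral_const_mul, ← integral_add hi2 (hgi.const_mul J)]
  refine setIntegral_congr_fun measurableSet_Ioc fun t _ => ?_
  simp only [hg, hM, expPrimitive]
  ring

theorem continuousOn_expPrimitive {B : ℝ} (hB : 0 < B) (α J : ℝ) {N : ℝ → ℝ}
    (hN : IntegrableOn N (Ioc 0 B)) : ContinuousOn (expPrimitive α J N) (Icc 0 B) := by
  have hMi : IntegrableOn (fun s => Real.exp (-α * s) * N s) (Icc 0 B) :=
    ((integrableOn_Icc_iff_integrableOn_Ioc).2 hN).continuousOn_mul (by fun_prop) isCompact_Icc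
  have := intervalIntegral.continuousOn_primitive_interval (a := (0:ℝ)) (b := B)
      (f := fun s => Real.exp (-α * s) * N s) (by rwa [uIcc_of_le hB.le])
  rw [uIcc_of_le hB.le] at this
  unfold expPrimitive
  fun_prop

/-- Representation of the derivative `f` of a distributional solution `V` of
`V'' + b V' + k V = N`, `V(0) = I`, `V'(0) = J`, where `α` and `β` are the characteristic roots. -/
theorem ae_eq_of_weak_ode {B b k α β I J : ℝ} (hB : 0 < B) (hαβ : β < α) (hsum : α + β = -b)
    (hmul : α * β = k) {V f N : ℝ → ℝ} (hf : IntegrableOn f (Ioc 0 B))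
    (hN : IntegrableOn N (Ioc 0 B))
    (hVf : ∀ η : ℝ → ℝ, ContDiff ℝ ∞ η → HasCompactSupport η → tsupport η ⊆ Ioo 0 B →
      ∫ t in Ioc 0 B, V t * deriv η t = -∫ t in Ioc 0 B, f t * η t)
    (hVN : ∀ ζ : ℝ → ℝ, ContDiff ℝ ∞ ζ → HasCompactSupport ζ → tsupport ζ ⊆ Iio B →
      ∫ t in Ioc 0 B, V t * (deriv (deriv ζ) t - b * deriv ζ t + k * ζ t) =
        (∫ t in Ioc 0 B, N t * ζ t) + ((J + b * I) * ζ 0 - I * deriv ζ 0)) :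
    ∀ᵐ t, t ∈ Ioo 0 B → f t =
      (α * expPrimitive α J N t - β * expPrimitive β J N t) / (α - β) -
        k * I / (α - β) * (Real.exp (α * t) - Real.exp (β * t)) := by
  have hD : α - β ≠ 0 := by linarith
  set G : ℝ → ℝ := fun t => (α * expPrimitive α J N t - β * expPrimitive β J N t) / (α - β) -
        k * I / (α - β) * (Real.exp (α * t) - Real.exp (β * t)) with hG
  have hGc : ContinuousOn G (Icc 0 B) := by
    have h1 := continuousOn_expPrimitive hB α J hN
    have h2 := continuousOn_expPrimitive hB β J hN
    fun_prop
  have hGi : IntegrableOn G (Ioc 0 B) := hGc.integrableOn_Icc.mono_set Ioc_subset_Icc_self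
  -- Duality: f and the candidate G are compared against each test function η, by inserting into the
  -- equation the solution ζ of the adjoint problem with source −η'.
  have key : ∀ᵐ t, t ∈ Ioo 0 B → f t - G t = 0 := by
    refine IsOpen.ae_eq_zero_of_integral_contDiff_smul_eq_zero isOpen_Ioo
      (((hf.sub hGi).mono_set Ioo_subset_Ioc_self).locallyIntegrableOn) ?_
    intro η hη hηc hηs
    have hηcont : Continuous η := hη.continuous
    have hη0 : ∀ s, s ∉ Ioo 0 B → η s = 0 := fun s hs =>
      image_eq_zero_of_notMem_tsupport fun h => hs (hηs h)
    obtain ⟨B', hB'B, hB'⟩ : ∃ B' < B, ∀ s, B' ≤ s → η s = 0 := by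
      rcases (tsupport η).eq_empty_or_nonempty with h | h
      · exact ⟨0, hB, fun s _ => image_eq_zero_of_notMem_tsupport (by simp [h])⟩
      · obtain ⟨m, hm, hmax⟩ := hηc.isCompact.exists_isGreatest h
        refine ⟨(m + B) / 2, by linarith [(hηs hm).2], fun s hs => ?_⟩
        refine image_eq_zero_of_notMem_tsupport fun hs' => ?_
        linarith [hmax hs', (hηs hm).2]
    set E₁ := expTail α B η with hE₁
    set E₂ := expTail β B η with hE₂
    have d₁ := hasDerivAt_expTail α B hηcont
    have d₂ := hasDerivAt_expTail β B hηcont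
    rw [← hE₁] at d₁
    rw [← hE₂] at d₂
    -- This ζ₀ solves ζ'' − bζ' + kζ = −η' and vanishes near B; `ζ₁` is its derivative.
    set ζ₀ : ℝ → ℝ := fun t => (α * E₁ t - β * E₂ t) / (α - β) with hζ₀
    have hζ₀s : ContDiff ℝ ∞ ζ₀ := by
      have h1 := contDiff_expTail α B hη
      have h2 := contDiff_expTail β B hη
      fun_prop
    have hdη : ∀ t, HasDerivAt η (deriv η t) t := fun t =>
      (hη.differentiable (by simp) t).hasDerivAt
    set ζ₁ : ℝ → ℝ := fun t => (-α ^ 2 * E₁ t + β ^ 2 * E₂ t) / (α - β) - η t with hζ₁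
    have dζ₀ : ∀ t, HasDerivAt ζ₀ (ζ₁ t) t := fun t => by
      refine ((((d₁ t).const_mul α).sub ((d₂ t).const_mul β)).div_const (α - β)).congr_deriv ?_
      simp only [hζ₁]; field_simp; ring
    have dζ₁ : ∀ t, HasDerivAt ζ₁ (b * ζ₁ t - k * ζ₀ t - deriv η t) t := fun t => by
      refine (((((d₁ t).const_mul (-α ^ 2)).add ((d₂ t).const_mul (β ^ 2))).div_const
        (α - β)).sub (hdη t)).congr_deriv ?_
      have hb : b = -(α + β) := by linarith
      simp only [hζ₁, hζ₀, hb, ← hmul]; field_simp; ring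
    -- For negative times ζ₀ need not have compact support; the cutoff repairs this and is 1 near
    -- [0, B], so nothing changes there.
    let χ : ContDiffBump (0 : ℝ) := ⟨B + 1, B + 2, by linarith, by linarith⟩
    set ζ : ℝ → ℝ := fun t => χ t * ζ₀ t with hζ
    have hloc : ∀ t ∈ Icc 0 B, ζ =ᶠ[nhds t] ζ₀ := by
      intro t ht
      have : t ∈ Metric.ball (0 : ℝ) χ.rIn := by
        rw [Metric.mem_ball, Real.dist_eq, sub_zero, abs_of_nonneg ht.1]
        change t < B + 1
        linarith [ht.2]
      filter_upwards [χ.eventuallyEq_one_of_mem_ball this] with s hs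
      simp [hζ, hs]
    have hdloc : ∀ t ∈ Icc 0 B, deriv ζ =ᶠ[nhds t] ζ₁ := fun t ht => by
      rw [← funext fun t => (dζ₀ t).deriv]
      exact (hloc t ht).deriv
    have hζs : ContDiff ℝ ∞ ζ := χ.contDiff.mul hζ₀s
    have hζc : HasCompactSupport ζ := χ.hasCompactSupport.mul_right
    have hζsupp : tsupport ζ ⊆ Iio B := by
      refine (closure_minimal (t := Iic B') ?_ isClosed_Iic).trans fun t ht => lt_of_le_of_lt ht hB'B
      intro t ht
      by_contra hlt
      refine ht ?_
      have hlt' : B' ≤ t := (not_le.1 hlt).le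
      simp [hζ, hζ₀, hE₁, hE₂, expTail_eq_zero hB'B.le hB' hlt']
    have e1 := hVN ζ hζs hζc hζsupp
    have e2 := hVf η hη hηc hηs
    have e3 : ∫ t in Ioc 0 B, V t * (deriv (deriv ζ) t - b * deriv ζ t + k * ζ t) =
        -∫ t in Ioc 0 B, V t * deriv η t := by
      rw [← integral_neg]
      refine setIntegral_congr_fun measurableSet_Ioc fun t ht => ?_
      have ht' := Ioc_subset_Icc_self ht
      rw [(hdloc t ht').deriv_eq, (dζ₁ t).deriv, (hdloc t ht').eq_of_nhds, (hloc t ht').eq_of_nhds]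
      ring
    have h0m : (0:ℝ) ∈ Icc 0 B := ⟨le_rfl, hB.le⟩
    have e4 : ∫ t in Ioc 0 B, N t * ζ t = ∫ t in Ioc 0 B, (α / (α - β) * (N t * E₁ t) -
        β / (α - β) * (N t * E₂ t)) := by
      refine setIntegral_congr_fun measurableSet_Ioc fun t ht => ?_
      rw [(hloc t (Ioc_subset_Icc_self ht)).eq_of_nhds]
      simp only [hζ₀]; ring
    have hNE : ∀ γ : ℝ, IntegrableOn (fun t => N t * expTail γ B η t) (Ioc 0 B) := fun γ => by
      have h := ((integrableOn_Icc_iff_integrableOn_Ioc).2 hN).mul_continuousOn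
        (contDiff_expTail γ B hη).continuous.continuousOn isCompact_Icc
      exact h.mono_set Ioc_subset_Icc_self
    rw [integral_sub ((hNE α).const_mul _) ((hNE β).const_mul _), integral_const_mul,
      integral_const_mul] at e4
    have a1 := integral_mul_expTail hB α J hN hηcont
    have a2 := integral_mul_expTail hB β J hN hηcont
    rw [e3, e2, neg_neg, e4, (hdloc 0 h0m).eq_of_nhds, (hloc 0 h0m).eq_of_nhds] at e1
    have hηY : ∀ γ : ℝ, IntegrableOn (fun t => η t * expPrimitive γ J N t) (Ioc 0 B) := fun γ =>
      ((hηcont.continuousOn.mul (continuousOn_expPrimitive hB γ J hN)).integrableOn_Icc).mono_set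
        Ioc_subset_Icc_self
    have hηe : ∀ γ : ℝ, IntegrableOn (fun t => Real.exp (γ * t) * η t) (Ioc 0 B) := fun γ =>
      ((by fun_prop : Continuous fun t => Real.exp (γ * t) * η t).integrableOn_Icc).mono_set
        Ioc_subset_Icc_self
    have hE0 : ∀ γ, expTail γ B η 0 = ∫ t in Ioc 0 B, Real.exp (γ * t) * η t := fun γ => by
      rw [expTail, intervalIntegral.integral_of_le hB.le]; simp
    have hηG : ∫ t in Ioc 0 B, η t * G t =
        α / (α - β) * (∫ t in Ioc 0 B, η t * expPrimitive α J N t) -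
        β / (α - β) * (∫ t in Ioc 0 B, η t * expPrimitive β J N t) -
        (k * I / (α - β) * (∫ t in Ioc 0 B, Real.exp (α * t) * η t) -
         k * I / (α - β) * (∫ t in Ioc 0 B, Real.exp (β * t) * η t)) := by
      have i1 : IntegrableOn (fun t => α / (α - β) * (η t * expPrimitive α J N t) -
          β / (α - β) * (η t * expPrimitive β J N t)) (Ioc 0 B) :=
        ((hηY α).const_mul _).sub ((hηY β).const_mul _)
      have i2 : IntegrableOn (fun t => k * I / (α - β) * (Real.exp (α * t) * η t) -
          k * I / (α - β) * (Real.exp (β * t) * η t)) (Ioc 0 B) :=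
        ((hηe α).const_mul _).sub ((hηe β).const_mul _)
      simp only [← integral_const_mul]
      rw [← integral_sub ((hηY α).const_mul _) ((hηY β).const_mul _),
        ← integral_sub ((hηe α).const_mul _) ((hηe β).const_mul _), ← integral_sub i1 i2]
      refine setIntegral_congr_fun measurableSet_Ioc fun t ht => ?_
      simp only [hG]; ring
    have hηf : IntegrableOn (fun t => f t * η t) (Ioc 0 B) :=
      (((integrableOn_Icc_iff_integrableOn_Ioc).2 hf).mul_continuousOn
        hηcont.continuousOn isCompact_Icc).mono_set Ioc_subset_Icc_self
    have hηGi : IntegrableOn (fun t => η t * G t) (Ioc 0 B) :=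
      ((hηcont.continuousOn.mul hGc).integrableOn_Icc).mono_set Ioc_subset_Icc_self
    -- Adjointness puts J into `expPrimitive`. As η(0) = 0, the remaining boundary term I(bζ(0) −
    -- ζ'(0)) equals −kI(E₁(0) − E₂(0))/(α − β), which is the data term of G.
    have hfin : ∫ t in Ioc 0 B, f t * η t = ∫ t in Ioc 0 B, η t * G t := by
      rw [hηG, e1, ← a1, ← a2, ← hE0, ← hE0]
      have hη00 : η 0 = 0 := hη0 0 (by simp)
      have hb : b = -(α + β) := by linarith
      simp only [hζ₁, hζ₀, ← hE₁, ← hE₂, hη00, ← hmul, hb]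
      field_simp
      ring
    rw [← setIntegral_eq_integral_of_forall_compl_eq_zero (s := Ioc 0 B)
      (fun t ht => by rw [hη0 t fun h => ht (Ioo_subset_Ioc_self h), zero_smul])]
    have : ∀ t, η t • (f t - G t) = f t * η t - η t * G t := fun t => by
      simp only [smul_eq_mul]; ring
    simp only [this]
    rw [integral_sub hηf hηGi, hfin, sub_self]
  filter_upwards [key] with t ht hmem
  linarith [ht hmem]

/-! ### The plane exponential and reduction to time integrals -/

/-- The plane exponential `e^{l x_a}`, an eigenfunction of the Laplacian. -/
noncomputable def planeExp {n : ℕ} (a : Fin n) (l : ℝ) (x : Space n) : ℝ := Real.exp (l * x a)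

theorem planeExp_pos {n : ℕ} (a : Fin n) (l : ℝ) (x : Space n) : 0 < planeExp a l x :=
  Real.exp_pos _

theorem contDiff_planeExp {n : ℕ} (a : Fin n) (l : ℝ) : ContDiff ℝ ∞ (planeExp a l) := by
  unfold planeExp
  fun_prop

theorem continuous_planeExp {n : ℕ} (a : Fin n) (l : ℝ) : Continuous (planeExp a l) :=
  (contDiff_planeExp a l).continuous

theorem laplacian_const_mul_planeExp {n : ℕ} (a : Fin n) (l k : ℝ) (x : Space n) :
    Laplacian.laplacian (fun y : Space n => k * planeExp a l y) x = l ^ 2 * (k * planeExp a l x) := by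
  set p : Space n →L[ℝ] ℝ := EuclideanSpace.proj a with hp
  have hpa : ∀ y : Space n, p y = y a := fun y => rfl
  have h1 : ∀ (k' : ℝ) (y : Space n),
      HasFDerivAt (fun y : Space n => k' * planeExp a l y) ((k' * l * planeExp a l y) • p) y := by
    intro k' y
    have h := (((p.hasFDerivAt (x := y)).const_mul l).exp).const_mul k'
    refine h.congr_fderiv ?_
    ext v
    simp only [_root_.smul_apply, smul_eq_mul, planeExp, hpa]
    ring
  have h2 : fderiv ℝ (fun y : Space n => k * planeExp a l y) =
      fun y => (k * l * planeExp a l y) • p := funext fun y => (h1 k y).fderiv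
  have h3 : HasFDerivAt (fun y => (k * l * planeExp a l y) • p)
      (((k * l * l * planeExp a l x) • p).smulRight p) x := (h1 (k * l) x).smul_const p
  rw [InnerProductSpace.laplacian_eq_iteratedFDeriv_orthonormalBasis _
    (EuclideanSpace.basisFun (Fin n) ℝ)]
  simp only [iteratedFDeriv_two_apply, h2, h3.fderiv]
  simp only [Matrix.cons_val_zero, Matrix.cons_val_one, ContinuousLinearMap.smulRight_apply,
    _root_.smul_apply, hpa, smul_eq_mul, EuclideanSpace.basisFun_apply]
  rw [Finset.sum_eq_single a]
  · simp; ring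
  · intro i _ hi
    simp [hi.symm]
  · simp

/-- The integral of `g(t, ·) e^{l x_a}` over the ball of radius `r`. -/
noncomputable def expMean {n : ℕ} (a : Fin n) (l r : ℝ) (g : ℝ × Space n → ℝ) (t : ℝ) : ℝ :=
  ∫ x in Metric.closedBall (0 : Space n) r, g (t, x) * planeExp a l x

theorem measurableSet_slab (n : ℕ) (T : EReal) : MeasurableSet (slab n T) :=
  (measurableSet_le measurable_const measurable_fst).inter
    (measurableSet_lt (measurable_coe_real_ereal.comp measurable_fst) measurable_const)

theorem Icc_prod_subset_slab {n : ℕ} {T : EReal} {B : ℝ} (hBT : (B : EReal) < T)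
    (K : Set (Space n)) : Icc 0 B ×ˢ K ⊆ slab n T := fun _ hz =>
  ⟨hz.1.1, lt_of_le_of_lt (EReal.coe_le_coe_iff.2 hz.1.2) hBT⟩

theorem SupportedInCone.eq_zero {n : ℕ} {R : ℝ} {T : EReal} {w : ℝ × Space n → ℝ}
    (hw : SupportedInCone n R T w) {z : ℝ × Space n} (hz : z ∈ slab n T) (hx : R + z.1 < ‖z.2‖) :
    w z = 0 := by
  by_contra h
  have : z.2 ∈ Metric.closedBall (0 : Space n) (R + z.1) :=
    hw z.1 hz.1 hz.2 (subset_tsupport _ h)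
  rw [mem_closedBall_zero_iff] at this
  linarith

theorem timeDeriv_eq_zero_of_notMem_tsupport {n : ℕ} {φ : ℝ × Space n → ℝ} {z : ℝ × Space n}
    (hz : z ∉ tsupport φ) : timeDeriv φ z = 0 := by
  have h : φ =ᶠ[nhds z] 0 := notMem_tsupport_iff_eventuallyEq.1 hz
  have h2 : (fun s : ℝ => φ (s, z.2)) =ᶠ[nhds z.1] fun _ => 0 :=
    ((by fun_prop : Continuous fun s : ℝ => (s, z.2)).continuousAt (x := z.1)).eventually h
  rw [timeDeriv, h2.deriv_eq, deriv_const]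

/-- The weak time derivative of a function supported in the cone vanishes outside the cone. -/
theorem HasWeakTimeDeriv.ae_eq_zero {n : ℕ} {R B : ℝ} {T : EReal} {w wt : ℝ × Space n → ℝ}
    (hBT : (B : EReal) < T) (hd : HasWeakTimeDeriv n T w wt) (hw : SupportedInCone n R T w) :
    ∀ᵐ z : ℝ × Space n, z.1 ∈ Ioo 0 B → R + z.1 < ‖z.2‖ → wt z = 0 := by
  set O : Set (ℝ × Space n) := {z | z.1 ∈ Ioo 0 B ∧ R + z.1 < ‖z.2‖} with hO
  have hOo : IsOpen O := (isOpen_Ioo.preimage continuous_fst).inter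
    (isOpen_lt (continuous_const.add continuous_fst) continuous_snd.norm)
  have hOs : O ⊆ slab n T := fun z hz =>
    ⟨hz.1.1.le, lt_trans (EReal.coe_lt_coe_iff.2 hz.1.2) hBT⟩
  -- A test function supported in the open set O meets w only where w = 0, so the weak derivative
  -- vanishes there as a distribution.
  have key : ∀ᵐ z, z ∈ O → wt z = 0 := by
    refine hOo.ae_eq_zero_of_integral_contDiff_smul_eq_zero
      (hd.locallyIntegrable.mono_set hOs) fun φ hφ hφc hφs => ?_
    have h := hd.integral_eq φ ⟨hφ, hφc, fun z hz => (hOs (hφs hz)).2⟩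
      (fun z hz => (hφs hz).1.1)
    have h1 : ∫ z in slab n T, w z * timeDeriv φ z = 0 := by
      rw [setIntegral_congr_fun (measurableSet_slab n T) (g := fun _ => 0), integral_zero]
      intro z hz
      by_cases hzφ : z ∈ tsupport φ
      · simp [hw.eq_zero hz (hφs hzφ).2]
      · simp [timeDeriv_eq_zero_of_notMem_tsupport hzφ]
    rw [h1] at h
    rw [← setIntegral_eq_integral_of_forall_compl_eq_zero (s := slab n T)]
    · simp only [smul_eq_mul, mul_comm (φ _)]
      linarith
    · intro z hz
      rw [image_eq_zero_of_notMem_tsupport fun h => hz (hOs (hφs h)), zero_smul]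
  filter_upwards [key] with z hz h1 h2 using hz ⟨h1, h2⟩

theorem integrableOn_mul_planeExp {n : ℕ} (a : Fin n) (l : ℝ) {r B : ℝ} {g : ℝ × Space n → ℝ}
    (hg : IntegrableOn g (Icc 0 B ×ˢ Metric.closedBall (0 : Space n) r)) {ξ : ℝ → ℝ}
    (hξ : Continuous ξ) :
    IntegrableOn (fun z => g z * (ξ z.1 * planeExp a l z.2))
      (Ioc 0 B ×ˢ Metric.closedBall (0 : Space n) r) := by
  have hc := continuous_planeExp (n := n) a l
  exact (hg.mul_continuousOn (by fun_prop)
    (isCompact_Icc.prod (isCompact_closedBall _ _))).mono_set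
    (prod_mono Ioc_subset_Icc_self subset_rfl)

theorem integrable_prod_of_integrableOn {n : ℕ} {r B : ℝ} {g : ℝ × Space n → ℝ}
    (hg : IntegrableOn g (Ioc 0 B ×ˢ Metric.closedBall (0 : Space n) r)) :
    Integrable g ((volume.restrict (Ioc 0 B)).prod
      (volume.restrict (Metric.closedBall (0 : Space n) r))) := by
  rwa [IntegrableOn, Measure.volume_eq_prod, ← Measure.prod_restrict] at hg

theorem integrableOn_expMean {n : ℕ} (a : Fin n) (l : ℝ) {r B : ℝ} {g : ℝ × Space n → ℝ}
    (hg : IntegrableOn g (Icc 0 B ×ˢ Metric.closedBall (0 : Space n) r)) :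
    IntegrableOn (expMean a l r g) (Ioc 0 B) := by
  have := integrable_prod_of_integrableOn (integrableOn_mul_planeExp a l hg (ξ := fun _ => 1)
    continuous_const)
  have h := this.integral_prod_left
  simp only [one_mul] at h
  exact h

/-- Space-time integrals over the slab against a test function that is `ξ(t) e^{l x_a}` on the
relevant cylinder reduce to time integrals. -/
theorem setIntegral_slab_eq {n : ℕ} (a : Fin n) (l : ℝ) {r B : ℝ} {T : EReal}
    (hBT : (B : EReal) < T) {g θ : ℝ × Space n → ℝ} {ξ : ℝ → ℝ}
    (hg : IntegrableOn g (Icc 0 B ×ˢ Metric.closedBall (0 : Space n) r))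
    (hg0 : ∀ᵐ z : ℝ × Space n, z.1 ∈ Ioo 0 B → r < ‖z.2‖ → g z = 0) (hξ : Continuous ξ)
    (hθ : ∀ z : ℝ × Space n, B ≤ z.1 → θ z = 0)
    (hθξ : ∀ z ∈ Ioc 0 B ×ˢ Metric.closedBall (0 : Space n) r,
      θ z = ξ z.1 * planeExp a l z.2) :
    ∫ z in slab n T, g z * θ z = ∫ t in Ioc 0 B, expMean a l r g t * ξ t := by
  set Q := Ioc 0 B ×ˢ Metric.closedBall (0 : Space n) r with hQ
  have hQm : MeasurableSet Q := measurableSet_Ioc.prod Metric.isClosed_closedBall.measurableSet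
  -- The slab contains the slice t = 0, on which `hg0` says nothing; it is a null set.
  have h0 : ∀ᵐ z : ℝ × Space n, z.1 ≠ 0 :=
    Measure.quasiMeasurePreserving_fst.ae (Measure.ae_ne volume (0 : ℝ))
  rw [setIntegral_eq_of_subset_of_ae_sdiff_eq_zero (s := Q)
    (measurableSet_slab n T).nullMeasurableSet
    ((prod_mono Ioc_subset_Icc_self subset_rfl).trans (Icc_prod_subset_slab hBT _))]
  · rw [setIntegral_congr_fun hQm (g := fun z => g z * (ξ z.1 * planeExp a l z.2))
      (fun z hz => by simp only [hθξ z hz])]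
    rw [Measure.volume_eq_prod, setIntegral_prod _
      (by simpa [Measure.volume_eq_prod] using integrableOn_mul_planeExp a l hg hξ)]
    refine setIntegral_congr_fun measurableSet_Ioc fun t _ => ?_
    simp only [expMean, ← integral_mul_const]
    congr 1
    ext x
    ring
  · filter_upwards [h0, hg0] with z hz0 hz hzd
    rcases le_or_gt B z.1 with h | h
    · rw [hθ z h, mul_zero]
    · have hpos : 0 < z.1 := lt_of_le_of_ne hzd.1.1 (Ne.symm hz0)
      rw [hz ⟨hpos, h⟩, zero_mul]
      by_contra hle
      exact hzd.2 ⟨⟨hpos, h.le⟩, by simpa using hle⟩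

/-! ### Product test functions with a spatial cutoff -/

section Cutoff

variable {n : ℕ} (a : Fin n) (l : ℝ) (χ : ContDiffBump (0 : Space n)) (ζ : ℝ → ℝ)

/-- The test function `ζ(t) χ(x) e^{l x_a}`. -/
noncomputable def cutoffExp (z : ℝ × Space n) : ℝ := ζ z.1 * (χ z.2 * planeExp a l z.2)

theorem timeDeriv_cutoffExp (hζ : Differentiable ℝ ζ) :
    timeDeriv (cutoffExp a l χ ζ) = cutoffExp a l χ (deriv ζ) := by
  ext z
  exact ((hζ z.1).hasDerivAt.mul_const (χ z.2 * planeExp a l z.2)).deriv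

variable {χ ζ}

theorem cutoffExp_eq {z : ℝ × Space n} (hz : z.2 ∈ Metric.closedBall (0 : Space n) χ.rIn) :
    cutoffExp a l χ ζ z = ζ z.1 * planeExp a l z.2 := by
  rw [cutoffExp, χ.one_of_mem_closedBall hz, one_mul]

theorem cutoffExp_eq_zero {z : ℝ × Space n} (hz : ζ z.1 = 0) : cutoffExp a l χ ζ z = 0 := by
  rw [cutoffExp, hz, zero_mul]

theorem spaceLaplacian_cutoffExp {z : ℝ × Space n}
    (hz : z.2 ∈ Metric.ball (0 : Space n) χ.rIn) :
    spaceLaplacian (cutoffExp a l χ ζ) z = l ^ 2 * (ζ z.1 * planeExp a l z.2) := by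
  rw [← laplacian_const_mul_planeExp]
  have h : (fun y : Space n => cutoffExp a l χ ζ (z.1, y)) =ᶠ[nhds z.2]
      fun y => ζ z.1 * planeExp a l y := by
    filter_upwards [χ.eventuallyEq_one_of_mem_ball hz] with y hy
    simp [cutoffExp, hy]
  exact (InnerProductSpace.laplacian_congr_nhds h).eq_of_nhds

theorem spaceLaplacian_cutoffExp_eq_zero {z : ℝ × Space n} (hz : ζ z.1 = 0) :
    spaceLaplacian (cutoffExp a l χ ζ) z = 0 := by
  simp [spaceLaplacian, cutoffExp, hz]

theorem tsupport_cutoffExp_subset :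
    tsupport (cutoffExp a l χ ζ) ⊆ tsupport ζ ×ˢ Metric.closedBall (0 : Space n) χ.rOut := by
  refine closure_minimal (fun z hz => ⟨subset_tsupport _ fun h => hz ?_, ?_⟩)
    ((isClosed_tsupport ζ).prod Metric.isClosed_closedBall)
  · simp [cutoffExp, h]
  · rw [← χ.tsupport_eq]
    exact subset_tsupport _ fun h => hz (by simp [cutoffExp, h])

theorem isTestFunction_cutoffExp {T : EReal} {B : ℝ} (hBT : (B : EReal) < T)
    (hζ : ContDiff ℝ ∞ ζ) (hζc : HasCompactSupport ζ) (hζs : tsupport ζ ⊆ Iio B) :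
    IsTestFunction n T (cutoffExp a l χ ζ) where
  smooth := by
    have h1 := contDiff_planeExp (n := n) a l
    have h2 : ContDiff ℝ ∞ χ := χ.contDiff
    unfold cutoffExp
    fun_prop
  compact := (hζc.isCompact.prod (isCompact_closedBall (0 : Space n) χ.rOut)).of_isClosed_subset
    (isClosed_tsupport _) (tsupport_cutoffExp_subset a l)
  supp := fun _ hz => lt_trans
    (EReal.coe_lt_coe_iff.2 (hζs (tsupport_cutoffExp_subset a l hz).1)) hBT

end Cutoff

/-! ### Representation and lower bounds for the means of the time derivatives -/

/-- The exponentially weighted mean of `∂ₜw`, for a weak solution `w` of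
`∂ₜ²w - Δw + b ∂ₜw + c w = F` supported in the cone, in terms of the data and of `F`. -/
theorem SolvesWeakly.ae_expMean_eq {n : ℕ} (a : Fin n) {l R B b c α β : ℝ} {T : EReal}
    {w wt F : ℝ × Space n → ℝ} {f g : Space n → ℝ} (hR : 0 < R) (hB : 0 < B)
    (hBT : (B : EReal) < T) (hαβ : β < α) (hsum : α + β = -b) (hmul : α * β = c - l ^ 2)
    (hsol : SolvesWeakly n T b c F f g w) (hw : ContinuousOn w (slab n T))
    (hcone : SupportedInCone n R T w) (hd : HasWeakTimeDeriv n T w wt)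
    (hF : LocallyIntegrableOn F (slab n T))
    (hF0 : ∀ᵐ z : ℝ × Space n, z.1 ∈ Ioo 0 B → R + z.1 < ‖z.2‖ → F z = 0)
    (hf : Continuous f) (hg : Continuous g) (hfs : tsupport f ⊆ Metric.closedBall 0 R)
    (hgs : tsupport g ⊆ Metric.closedBall 0 R) :
    ∀ᵐ t, t ∈ Ioo 0 B → expMean a l (R + B) wt t =
      (α * expPrimitive α (∫ x, g x * planeExp a l x) (expMean a l (R + B) F) t -
        β * expPrimitive β (∫ x, g x * planeExp a l x) (expMean a l (R + B) F) t) / (α - β) -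
        (c - l ^ 2) * (∫ x, f x * planeExp a l x) / (α - β) *
          (Real.exp (α * t) - Real.exp (β * t)) := by
  set K := Metric.closedBall (0 : Space n) (R + B) with hK
  have hQc : IsCompact (Icc 0 B ×ˢ K) := isCompact_Icc.prod (isCompact_closedBall _ _)
  have hQs : Icc 0 B ×ˢ K ⊆ slab n T := Icc_prod_subset_slab hBT K
  have hwi : IntegrableOn w (Icc 0 B ×ˢ K) := (hw.mono hQs).integrableOn_compact hQc
  have hwti : IntegrableOn wt (Icc 0 B ×ˢ K) :=
    hd.locallyIntegrable.integrableOn_compact_subset hQs hQc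
  have hFi : IntegrableOn F (Icc 0 B ×ˢ K) := hF.integrableOn_compact_subset hQs hQc
  have hw0 : ∀ᵐ z : ℝ × Space n, z.1 ∈ Ioo 0 B → R + B < ‖z.2‖ → w z = 0 :=
    Filter.Eventually.of_forall fun z hz hzn =>
      hcone.eq_zero ⟨hz.1.le, lt_trans (EReal.coe_lt_coe_iff.2 hz.2) hBT⟩ (by linarith [hz.2])
  have hwt0 : ∀ᵐ z : ℝ × Space n, z.1 ∈ Ioo 0 B → R + B < ‖z.2‖ → wt z = 0 := by
    filter_upwards [hd.ae_eq_zero hBT hcone] with z hz h1 h2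
    exact hz h1 (by linarith [h1.2])
  have hF0' : ∀ᵐ z : ℝ × Space n, z.1 ∈ Ioo 0 B → R + B < ‖z.2‖ → F z = 0 := by
    filter_upwards [hF0] with z hz h1 h2
    exact hz h1 (by linarith [h1.2])
  -- The inner radius strictly exceeds R + B, so χ = 1 in a neighbourhood of K and the Laplacian of
  -- the test function is exactly l² times it on K.
  let χ : ContDiffBump (0 : Space n) := ⟨R + B + 1, R + B + 2, by linarith, by linarith⟩
  have hKb : ∀ x : Space n, x ∈ K → x ∈ Metric.ball (0 : Space n) χ.rIn := fun x hx =>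
    Metric.closedBall_subset_ball (by change R + B < R + B + 1; linarith) hx
  have hKχ : ∀ x : Space n, x ∈ K → x ∈ Metric.closedBall (0 : Space n) χ.rIn := fun x hx =>
    Metric.ball_subset_closedBall (hKb x hx)
  have hvan : ∀ ζ : ℝ → ℝ, tsupport ζ ⊆ Iio B → ∀ t, B ≤ t → ζ t = 0 := fun ζ hζ t ht =>
    image_eq_zero_of_notMem_tsupport fun h => absurd (hζ h) (not_lt.2 ht)
  have hdata : ∀ h : Space n → ℝ, Continuous h → tsupport h ⊆ Metric.closedBall 0 R →
      Integrable (fun x => h x * planeExp a l x) ∧ ∀ x, h x * χ x = h x := by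
    intro h hc hs
    refine ⟨Continuous.integrable_of_hasCompactSupport
      (hc.mul (continuous_planeExp a l)) ?_, fun x => ?_⟩
    · exact HasCompactSupport.mul_right
        ((isCompact_closedBall _ _).of_isClosed_subset (isClosed_tsupport h) hs)
    · by_cases hx : x ∈ tsupport h
      · rw [χ.one_of_mem_closedBall (hKχ x (Metric.closedBall_subset_closedBall (by linarith)
          (hs hx))), mul_one]
      · rw [image_eq_zero_of_notMem_tsupport hx, zero_mul]
  obtain ⟨hfi, hfχ⟩ := hdata f hf hfs
  obtain ⟨hgi, hgχ⟩ := hdata g hg hgs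
  refine ae_eq_of_weak_ode (V := expMean a l (R + B) w) hB hαβ hsum hmul
    (integrableOn_expMean a l hwti) (integrableOn_expMean a l hFi) ?_ ?_
  · intro η hη hηc hηs
    have hηB : tsupport η ⊆ Iio B := hηs.trans fun t ht => ht.2
    have hη' : ContDiff ℝ ∞ (deriv η) := (contDiff_infty_iff_deriv.1 hη).2
    have h := hd.integral_eq (cutoffExp a l χ η)
      (isTestFunction_cutoffExp a l hBT hη hηc hηB)
      (fun z hz => (hηs (tsupport_cutoffExp_subset a l hz).1).1)
    rw [timeDeriv_cutoffExp a l χ η (hη.differentiable (by simp)),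
      setIntegral_slab_eq a l hBT hwi hw0 hη'.continuous
        (fun z hz => cutoffExp_eq_zero a l
          (hvan _ ((tsupport_deriv_subset).trans hηB) _ hz))
        (fun z hz => cutoffExp_eq a l (hKχ _ hz.2)),
      setIntegral_slab_eq a l hBT hwti hwt0 hη.continuous
        (fun z hz => cutoffExp_eq_zero a l (hvan _ hηB _ hz))
        (fun z hz => cutoffExp_eq a l (hKχ _ hz.2))] at h
    exact h
  · intro ζ hζ hζc hζB
    have hζ' : ContDiff ℝ ∞ (deriv ζ) := (contDiff_infty_iff_deriv.1 hζ).2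
    have hζ'' : ContDiff ℝ ∞ (deriv (deriv ζ)) := (contDiff_infty_iff_deriv.1 hζ').2
    have hζB' : tsupport (deriv ζ) ⊆ Iio B := tsupport_deriv_subset.trans hζB
    have hζB'' : tsupport (deriv (deriv ζ)) ⊆ Iio B := tsupport_deriv_subset.trans hζB'
    have h := hsol (cutoffExp a l χ ζ) (isTestFunction_cutoffExp a l hBT hζ hζc hζB)
    rw [timeDeriv_cutoffExp a l χ ζ (hζ.differentiable (by simp)),
      timeDeriv_cutoffExp a l χ (deriv ζ) (hζ'.differentiable (by simp)),
      setIntegral_slab_eq a l hBT hFi hF0' hζ.continuous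
        (fun z hz => cutoffExp_eq_zero a l (hvan _ hζB _ hz))
        (fun z hz => cutoffExp_eq a l (hKχ _ hz.2)),
      setIntegral_slab_eq a l hBT hwi hw0
        -- The Laplacian has become multiplication by l², turning the coefficient c into c − l², the
        -- product of the characteristic roots.
        (ξ := fun t => deriv (deriv ζ) t - b * deriv ζ t + (c - l ^ 2) * ζ t)
        (by have := hζ.continuous; have := hζ'.continuous; have := hζ''.continuous; fun_prop)
        (fun z hz => by
          rw [cutoffExp_eq_zero a l (hvan _ hζB'' _ hz), cutoffExp_eq_zero a l (hvan _ hζB' _ hz),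
            cutoffExp_eq_zero a l (hvan _ hζB _ hz),
            spaceLaplacian_cutoffExp_eq_zero a l (hvan _ hζB _ hz)]
          ring)
        (fun z hz => by
          rw [cutoffExp_eq a l (hKχ _ hz.2), cutoffExp_eq a l (hKχ _ hz.2),
            cutoffExp_eq a l (hKχ _ hz.2), spaceLaplacian_cutoffExp a l (hKb _ hz.2)]
          ring)] at h
    rw [h]
    congr 1
    have hpt : ∀ x : Space n, (g x + b * f x) * cutoffExp a l χ ζ (0, x) -
        f x * cutoffExp a l χ (deriv ζ) (0, x) =
        ζ 0 * (g x * planeExp a l x) + (b * ζ 0 - deriv ζ 0) * (f x * planeExp a l x) := by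
      intro x
      simp only [cutoffExp]
      linear_combination (ζ 0 * planeExp a l x) * hgχ x +
        ((b * ζ 0 - deriv ζ 0) * planeExp a l x) * hfχ x
    simp only [hpt]
    rw [integral_add (hgi.const_mul _) (hfi.const_mul _), integral_const_mul, integral_const_mul]
    ring

theorem expPrimitive_eq {α J t : ℝ} {N : ℝ → ℝ} :
    expPrimitive α J N t =
      Real.exp (α * t) * J + ∫ s in (0 : ℝ)..t, Real.exp (α * (t - s)) * N s := by
  rw [expPrimitive, mul_add, ← intervalIntegral.integral_const_mul]
  congr 2
  ext s
  rw [← mul_assoc, ← Real.exp_add]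
  congr 2
  ring

/-- In convolution form the kernel e^{γ(t−s)} increases with γ because s ≤ t, and it is applied to
nonnegative N and J. -/
theorem expPrimitive_mono {α β J B t : ℝ} {N : ℝ → ℝ} (hβα : β ≤ α) (hJ : 0 ≤ J)
    (hN0 : ∀ s, 0 ≤ N s) (hN : IntegrableOn N (Ioc 0 B)) (ht : t ∈ Icc 0 B) :
    expPrimitive β J N t ≤ expPrimitive α J N t := by
  have hi : ∀ γ : ℝ, IntervalIntegrable (fun s => Real.exp (γ * (t - s)) * N s) volume 0 t :=
    fun γ => by
      have h1 : IntervalIntegrable N volume 0 t :=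
        (intervalIntegrable_iff_integrableOn_Ioc_of_le ht.1).2
          (hN.mono_set (Ioc_subset_Ioc_right ht.2))
      exact h1.continuousOn_mul (by fun_prop)
  rw [expPrimitive_eq, expPrimitive_eq]
  refine add_le_add ?_ (intervalIntegral.integral_mono_on ht.1 (hi β) (hi α) fun s hs => ?_)
  · have := ht.1
    gcongr
  · have : 0 ≤ t - s := by linarith [hs.2]
    have := hN0 s
    gcongr

theorem expPrimitive_nonneg {α J t : ℝ} {N : ℝ → ℝ} (hJ : 0 ≤ J)
    (hN0 : ∀ s, 0 ≤ N s) (ht : 0 ≤ t) : 0 ≤ expPrimitive α J N t :=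
  mul_nonneg (Real.exp_pos _).le (add_nonneg hJ (intervalIntegral.integral_nonneg ht
    fun s _ => mul_nonneg (Real.exp_pos _).le (hN0 s)))

theorem expMean_nonneg {n : ℕ} (a : Fin n) (l r : ℝ) {g : ℝ × Space n → ℝ} (hg : ∀ z, 0 ≤ g z)
    (t : ℝ) : 0 ≤ expMean a l r g t :=
  integral_nonneg fun x => mul_nonneg (hg _) (planeExp_pos a l x).le

/-- Lower bound for the weighted mean of `∂ₜw` when `w` solves a damped Klein-Gordon equation whose
mass is dominated by the damping. -/
theorem SolvesWeakly.ae_expPrimitive_le_expMean_of_damped {n : ℕ} (a : Fin n) {R B b m : ℝ}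
    {T : EReal} {w wt F : ℝ × Space n → ℝ} {f g : Space n → ℝ} (hb : 0 < b)
    (hm : 4 * m ^ 2 ≤ b ^ 2) (hR : 0 < R) (hB : 0 < B) (hBT : (B : EReal) < T)
    (hsol : SolvesWeakly n T b (m ^ 2) F f g w) (hw : ContinuousOn w (slab n T))
    (hcone : SupportedInCone n R T w) (hd : HasWeakTimeDeriv n T w wt)
    (hF : LocallyIntegrableOn F (slab n T))
    (hF0 : ∀ᵐ z : ℝ × Space n, z.1 ∈ Ioo 0 B → R + z.1 < ‖z.2‖ → F z = 0)
    (hFn : ∀ z, 0 ≤ F z) (hf : Continuous f) (hg : Continuous g)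
    (hfs : tsupport f ⊆ Metric.closedBall 0 R) (hgs : tsupport g ⊆ Metric.closedBall 0 R)
    (hfn : ∀ x, 0 ≤ f x) (hgn : ∀ x, 0 ≤ g x) :
    ∀ᵐ t, t ∈ Ioo 0 B →
      expPrimitive (-2 * b) 0 (expMean a b (R + B) F) t ≤ expMean a b (R + B) wt t := by
  set D := √(5 * b ^ 2 - 4 * m ^ 2) with hD
  have hDsq : D ^ 2 = 5 * b ^ 2 - 4 * m ^ 2 := Real.sq_sqrt (by nlinarith)
  have hDnn : 0 ≤ D := Real.sqrt_nonneg _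
  -- These two bounds place the roots (−b ± D)/2: the larger is nonnegative, and the smaller is at
  -- least −2b, a rate that does not depend on m.
  have hDb : b ≤ D := by nlinarith
  have hD3 : D ≤ 3 * b := by nlinarith
  have hFi : IntegrableOn (expMean a b (R + B) F) (Ioc 0 B) :=
    integrableOn_expMean a b (hF.integrableOn_compact_subset (Icc_prod_subset_slab hBT _)
      (isCompact_Icc.prod (isCompact_closedBall _ _)))
  have hrep := hsol.ae_expMean_eq a (l := b) (α := (-b + D) / 2) (β := (-b - D) / 2) hR hB hBT
    (by linarith) (by ring) (by linear_combination (-1 / 4) * hDsq) hw hcone hd hF hF0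
    hf hg hfs hgs
  filter_upwards [hrep] with t ht htB
  rw [ht htB]
  have htI : t ∈ Icc 0 B := Ioo_subset_Icc_self htB
  set J := ∫ x, g x * planeExp a b x with hJ
  have hJn : 0 ≤ J := integral_nonneg fun x => mul_nonneg (hgn x) (planeExp_pos a b x).le
  have hIn : 0 ≤ ∫ x, f x * planeExp a b x :=
    integral_nonneg fun x => mul_nonneg (hfn x) (planeExp_pos a b x).le
  have hMn := expMean_nonneg a b (R + B) hFn
  have h1 : expPrimitive ((-b - D) / 2) J (expMean a b (R + B) F) t ≤
      expPrimitive ((-b + D) / 2) J (expMean a b (R + B) F) t :=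
    expPrimitive_mono (by linarith) hJn hMn hFi htI
  have h2 : expPrimitive (-2 * b) J (expMean a b (R + B) F) t ≤
      expPrimitive ((-b - D) / 2) J (expMean a b (R + B) F) t :=
    expPrimitive_mono (by linarith) hJn hMn hFi htI
  have h3 : expPrimitive (-2 * b) 0 (expMean a b (R + B) F) t ≤
      expPrimitive (-2 * b) J (expMean a b (R + B) F) t := by
    unfold expPrimitive; gcongr
  have hDD : (-b + D) / 2 - (-b - D) / 2 = D := by ring
  rw [hDD]
  -- The frequency l = b dominates the mass, m² ≤ b², so the contribution of the initial position
  -- has a favourable sign.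
  have h4 : (m ^ 2 - b ^ 2) * (∫ x, f x * planeExp a b x) / D *
      (Real.exp ((-b + D) / 2 * t) - Real.exp ((-b - D) / 2 * t)) ≤ 0 := by
    refine mul_nonpos_of_nonpos_of_nonneg (div_nonpos_of_nonpos_of_nonneg
      (mul_nonpos_of_nonpos_of_nonneg (by nlinarith) hIn) hDnn) ?_
    rw [sub_nonneg, Real.exp_le_exp]
    exact mul_le_mul_of_nonneg_right (by linarith) htB.1.le
  -- With α ≥ 0, replacing Y_α by the smaller Y_β leaves (α − β)Y_β/D = Y_β.
  have h5 : expPrimitive ((-b - D) / 2) J (expMean a b (R + B) F) t ≤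
      ((-b + D) / 2 * expPrimitive ((-b + D) / 2) J (expMean a b (R + B) F) t -
        (-b - D) / 2 * expPrimitive ((-b - D) / 2) J (expMean a b (R + B) F) t) / D := by
    rw [le_div_iff₀ (by linarith)]
    nlinarith
  linarith

/-- Lower bound for the weighted mean of `∂ₜw` when `w` solves a wave equation. -/
theorem SolvesWeakly.ae_expPrimitive_le_expMean_of_wave {n : ℕ} (a : Fin n) {R B l : ℝ}
    {T : EReal} {w wt F : ℝ × Space n → ℝ} {f g : Space n → ℝ} (hl : 0 < l)
    (hR : 0 < R) (hB : 0 < B) (hBT : (B : EReal) < T)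
    (hsol : SolvesWeakly n T 0 0 F f g w) (hw : ContinuousOn w (slab n T))
    (hcone : SupportedInCone n R T w) (hd : HasWeakTimeDeriv n T w wt)
    (hF : LocallyIntegrableOn F (slab n T))
    (hF0 : ∀ᵐ z : ℝ × Space n, z.1 ∈ Ioo 0 B → R + z.1 < ‖z.2‖ → F z = 0)
    (hFn : ∀ z, 0 ≤ F z) (hf : Continuous f) (hg : Continuous g)
    (hfs : tsupport f ⊆ Metric.closedBall 0 R) (hgs : tsupport g ⊆ Metric.closedBall 0 R)
    (hfn : ∀ x, 0 ≤ f x) (hgn : ∀ x, 0 ≤ g x) :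
    ∀ᵐ t, t ∈ Ioo 0 B →
      expPrimitive l (∫ x, g x * planeExp a l x) (expMean a l (R + B) F) t / 2 ≤
        expMean a l (R + B) wt t := by
  have hrep := hsol.ae_expMean_eq a (l := l) (α := l) (β := -l) hR hB hBT
    (by linarith) (by ring) (by ring) hw hcone hd hF hF0 hf hg hfs hgs
  filter_upwards [hrep] with t ht htB
  rw [ht htB]
  set J := ∫ x, g x * planeExp a l x with hJ
  have hJn : 0 ≤ J := integral_nonneg fun x => mul_nonneg (hgn x) (planeExp_pos a l x).le
  have hIn : 0 ≤ ∫ x, f x * planeExp a l x :=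
    integral_nonneg fun x => mul_nonneg (hfn x) (planeExp_pos a l x).le
  -- The decaying mode is nonnegative; discarding it leaves half of the growing mode.
  have h1 : 0 ≤ expPrimitive (-l) J (expMean a l (R + B) F) t :=
    expPrimitive_nonneg hJn (expMean_nonneg a l (R + B) hFn) htB.1.le
  have h4 : (0 - l ^ 2) * (∫ x, f x * planeExp a l x) / (l - -l) *
      (Real.exp (l * t) - Real.exp (-l * t)) ≤ 0 := by
    refine mul_nonpos_of_nonpos_of_nonneg (div_nonpos_of_nonpos_of_nonneg
      (mul_nonpos_of_nonpos_of_nonneg (by nlinarith) hIn) (by linarith)) ?_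
    rw [sub_nonneg, Real.exp_le_exp]
    exact mul_le_mul_of_nonneg_right (by linarith) htB.1.le
  have h5 : (l * expPrimitive l J (expMean a l (R + B) F) t -
      -l * expPrimitive (-l) J (expMean a l (R + B) F) t) / (l - -l) =
      expPrimitive l J (expMean a l (R + B) F) t / 2 +
      expPrimitive (-l) J (expMean a l (R + B) F) t / 2 := by
    field_simp; ring
  linarith

/-! ### Jensen's inequality on time slices -/

/-- Convexity: the tangent to y^p at s lies below the graph, here derived from Young's inequality.
Being affine in y, it can be integrated against a weight before s is chosen. -/
theorem rpow_tangent_le {p y s : ℝ} (hp : 1 < p) (hy : 0 ≤ y) (hs : 0 ≤ s) :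
    p * s ^ (p - 1) * y - (p - 1) * s ^ p ≤ y ^ p := by
  have hpq : p.HolderConjugate (p / (p - 1)) := Real.HolderConjugate.conjExponent hp
  have h := Real.young_inequality_of_nonneg hy (Real.rpow_nonneg hs (p - 1)) hpq
  have hp1 : p - 1 ≠ 0 := by linarith
  rw [← Real.rpow_mul hs, mul_div_cancel₀ _ hp1] at h
  have hp0 : 0 < p := by linarith
  have h' := mul_le_mul_of_nonneg_left h hp0.le
  have e : p * (y ^ p / p + s ^ p / (p / (p - 1))) = y ^ p + (p - 1) * s ^ p := by
    field_simp
  rw [e] at h'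
  linarith

/-- Jensen's inequality for the exponentially weighted means, on the time slices of the cone. -/
theorem HasWeakTimeDeriv.ae_rpow_le_expMean {n : ℕ} (a : Fin n) (l : ℝ) {R B p : ℝ} {T : EReal}
    {w wt : ℝ × Space n → ℝ} (hp : 1 < p) (hBT : (B : EReal) < T)
    (hd : HasWeakTimeDeriv n T w wt) (hcone : SupportedInCone n R T w)
    (hi : LocallyIntegrableOn (fun z => |wt z| ^ p) (slab n T)) :
    ∀ᵐ t, t ∈ Ioo 0 B → ∀ y A : ℝ, 0 ≤ y → y ≤ expMean a l (R + B) wt t → 0 < A →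
      ∫ x in Metric.closedBall (0 : Space n) (R + t), planeExp a l x ≤ A →
      y ^ p * A ^ (1 - p) ≤ expMean a l (R + B) (fun z => |wt z| ^ p) t := by
  set K := Metric.closedBall (0 : Space n) (R + B) with hK
  have hKm : MeasurableSet K := Metric.isClosed_closedBall.measurableSet
  have hQc : IsCompact (Icc 0 B ×ˢ K) := isCompact_Icc.prod (isCompact_closedBall _ _)
  have hQs : Icc 0 B ×ˢ K ⊆ slab n T := Icc_prod_subset_slab hBT K
  have i1 := (integrable_prod_of_integrableOn (integrableOn_mul_planeExp a l
    (hd.locallyIntegrable.integrableOn_compact_subset hQs hQc)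
    (ξ := fun _ => 1) continuous_const)).prod_right_ae
  have i2 := (integrable_prod_of_integrableOn (integrableOn_mul_planeExp a l
    (hi.integrableOn_compact_subset hQs hQc) (ξ := fun _ => 1) continuous_const)).prod_right_ae
  have h0 : ∀ᵐ t : ℝ, ∀ᵐ x : Space n, t ∈ Ioo 0 B → R + t < ‖x‖ → wt (t, x) = 0 :=
    Measure.ae_ae_of_ae_prod (hd.ae_eq_zero hBT hcone)
  rw [ae_restrict_iff' measurableSet_Ioc] at i1 i2
  filter_upwards [i1, i2, h0] with t h1 h2 h0 ht y A hy hyf hA hAle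
  have h1 := h1 (Ioo_subset_Ioc_self ht)
  have h2 := h2 (Ioo_subset_Ioc_self ht)
  simp only [one_mul] at h1 h2
  -- At this tangent point the bound p s^{p−1} y − (p−1) s^p A equals y^p A^{1−p}. The coefficients
  -- have fixed signs, so y and A need only be bounds for the mean and the mass.
  set s := y / A with hs
  have hsn : 0 ≤ s := div_nonneg hy hA.le
  set S := Metric.closedBall (0 : Space n) (R + t) with hS
  have hSm : MeasurableSet S := Metric.isClosed_closedBall.measurableSet
  have hSK : S ⊆ K := Metric.closedBall_subset_closedBall (by linarith [ht.2])
  have h3 : Integrable (S.indicator (planeExp a l)) (volume.restrict K) :=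
    (((continuous_planeExp a l).continuousOn.integrableOn_compact
      (isCompact_closedBall _ _)).mono_set subset_rfl).indicator hSm
  -- The constant of the tangent is subtracted only on the slice of the cone, since `wt` vanishes
  -- outside it; hence the mass of B_{R+t} enters and not that of B_{R+B}.
  have key : ∫ x in K, (p * s ^ (p - 1) * (wt (t, x) * planeExp a l x) -
      (p - 1) * s ^ p * S.indicator (planeExp a l) x) ≤
      ∫ x in K, |wt (t, x)| ^ p * planeExp a l x := by
    refine integral_mono_ae ((h1.const_mul _).sub (h3.const_mul _)) h2 ?_
    filter_upwards [ae_restrict_of_ae h0] with x hx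
    have hΦ := planeExp_pos a l x
    by_cases hxS : x ∈ S
    · rw [indicator_of_mem hxS]
      have hy := rpow_tangent_le hp (abs_nonneg (wt (t, x))) hsn
      have hle : p * s ^ (p - 1) * wt (t, x) ≤ p * s ^ (p - 1) * |wt (t, x)| :=
        mul_le_mul_of_nonneg_left (le_abs_self _) (by positivity)
      have : (p * s ^ (p - 1) * wt (t, x) - (p - 1) * s ^ p) * planeExp a l x ≤
          |wt (t, x)| ^ p * planeExp a l x := by
        refine mul_le_mul_of_nonneg_right ?_ hΦ.le
        linarith
      linarith
    · have hnorm : R + t < ‖x‖ := by simpa [hS] using hxS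
      rw [indicator_of_notMem hxS, hx ht hnorm, abs_zero, Real.zero_rpow (by linarith)]
      simp
  rw [integral_sub (h1.const_mul _) (h3.const_mul _), integral_const_mul, integral_const_mul,
    setIntegral_indicator hSm, inter_eq_self_of_subset_right hSK] at key
  have hps : 0 ≤ p * s ^ (p - 1) := by positivity
  have hps' : 0 ≤ (p - 1) * s ^ p := mul_nonneg (by linarith) (by positivity)
  have k1 := mul_le_mul_of_nonneg_left hyf hps
  have k2 := mul_le_mul_of_nonneg_left hAle hps'
  have e1 : s ^ (p - 1) * y = y ^ p * A ^ (1 - p) := by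
    rcases hy.eq_or_lt with h | h
    · rw [← h, mul_zero, Real.zero_rpow (by linarith), zero_mul]
    · rw [hs, Real.div_rpow hy hA.le, ← neg_sub p 1, Real.rpow_neg hA.le,
        Real.rpow_sub_one h.ne']
      field_simp
  have e2 : s ^ p * A = y ^ p * A ^ (1 - p) := by
    rw [hs, Real.div_rpow hy hA.le, Real.rpow_sub hA, Real.rpow_one]
    field_simp
  change _ ≤ ∫ x in K, |wt (t, x)| ^ p * planeExp a l x
  have k1' : p * s ^ (p - 1) * y ≤ p * s ^ (p - 1) * ∫ x in K, wt (t, x) * planeExp a l x := k1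
  nlinarith

/-! ### The superlinear integral inequality -/

/-- The growth estimate behind the blow-up: the functional `½ e^{-lt} expPrimitive l J N t` of the
pair of weighted means `(M, N)` satisfies a superlinear integral inequality with delay `τ`. -/
theorem add_rpow_mul_log_le {p q l R ν c₁ c₃ J B : ℝ} {M N : ℝ → ℝ} (hp : 1 < p) (hq : 1 < q)
    (hl : 0 < l) (hR : 0 < R) (hν : 0 ≤ ν) (hκ : ν * (p * q - 1) ≤ 1) (hc₁ : 0 < c₁)
    (hc₃ : 0 < c₃) (hJ : 0 ≤ J) (hM0 : ∀ t, 0 ≤ M t) (hN0 : ∀ t, 0 ≤ N t)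
    (hMi : IntegrableOn M (Ioc 0 B)) (hNi : IntegrableOn N (Ioc 0 B))
    (hM : ∀ᵐ t, t ∈ Ioo 0 B → (expPrimitive l J N t / 2) ^ p *
      (c₁ * (Real.exp (l * t) * (R + t) ^ ν) ^ (1 - p)) ≤ M t)
    (hN : ∀ᵐ t, t ∈ Ioo 0 B → ∀ y : ℝ, 0 ≤ y → y ≤ expPrimitive (-2 * l) 0 M t →
      y ^ q * (c₃ * (Real.exp (l * t) * (R + t) ^ ν) ^ (1 - q)) ≤ N t)
    {T₀ t₀ t₁ τ : ℝ} (hT₀ : 1 ≤ T₀) (ht₀ : T₀ ≤ t₀) (hτ : 0 < τ) (hτ1 : τ ≤ 1)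
    (ht₁ : t₀ + τ ≤ t₁) (ht₁B : t₁ ≤ B) :
    (J + ∫ s in (0 : ℝ)..t₀, Real.exp (-l * s) * N s) / 2 +
      ((c₁ * Real.exp (-3 * l)) ^ q * c₃ * (1 + R) ^ (-(ν * (p * q - 1))) / 2) * τ ^ q *
        ((J + ∫ s in (0 : ℝ)..t₀, Real.exp (-l * s) * N s) / 2) ^ (p * q) *
        T₀ ^ (1 - ν * (p * q - 1)) * Real.log (t₁ / (t₀ + τ)) ≤
      (J + ∫ s in (0 : ℝ)..t₁, Real.exp (-l * s) * N s) / 2 := by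
  set H : ℝ → ℝ := fun t => (J + ∫ s in (0 : ℝ)..t, Real.exp (-l * s) * N s) / 2 with hH
  set κ := ν * (p * q - 1) with hκdef
  have hpq : 1 < p * q := by nlinarith
  have hκ0 : 0 ≤ κ := mul_nonneg hν (by linarith)
  have hWi : IntegrableOn (fun s => Real.exp (-l * s) * N s) (Ioc 0 B) :=
    (((integrableOn_Icc_iff_integrableOn_Ioc).2 hNi).continuousOn_mul (by fun_prop)
      isCompact_Icc).mono_set Ioc_subset_Icc_self
  have hW0 : ∀ s, 0 ≤ Real.exp (-l * s) * N s := fun s => mul_nonneg (Real.exp_pos _).le (hN0 s)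
  have hWii : ∀ x y : ℝ, 0 ≤ x → x ≤ y → y ≤ B →
      IntervalIntegrable (fun s => Real.exp (-l * s) * N s) volume x y := fun x y hx hxy hy =>
    (intervalIntegrable_iff_integrableOn_Ioc_of_le hxy).2 (hWi.mono_set (Ioc_subset_Ioc hx hy))
  have hdiff : ∀ x y : ℝ, 0 ≤ x → x ≤ y → y ≤ B →
      H y - H x = (∫ s in x..y, Real.exp (-l * s) * N s) / 2 := by
    intro x y hx hxy hy
    have := intervalIntegral.integral_add_adjacent_intervals
      (hWii 0 x le_rfl hx (hxy.trans hy)) (hWii x y hx hxy hy)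
    simp only [hH]
    linarith
  have hmono : ∀ x y : ℝ, 0 ≤ x → x ≤ y → y ≤ B → H x ≤ H y := by
    intro x y hx hxy hy
    have h1 := hdiff x y hx hxy hy
    have h2 : 0 ≤ ∫ s in x..y, Real.exp (-l * s) * N s :=
      intervalIntegral.integral_nonneg hxy fun s _ => hW0 s
    linarith
  have ht₀0 : 0 < t₀ := by linarith
  have hH0 : 0 ≤ H t₀ := by
    have h2 : 0 ≤ ∫ s in (0:ℝ)..t₀, Real.exp (-l * s) * N s :=
      intervalIntegral.integral_nonneg ht₀0.le fun s _ => hW0 s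
    simp only [hH]; linarith
  have hHY : ∀ t, expPrimitive l J N t / 2 = Real.exp (l * t) * H t := fun t => by
    simp only [hH, expPrimitive]; ring
  set h := H t₀ with hh
  have hM' : ∀ᵐ s, s ∈ Ioo t₀ B →
      c₁ * Real.exp (l * s) * h ^ p * (R + s) ^ (-(ν * (p - 1))) ≤ M s := by
    filter_upwards [hM] with s hs hsI
    have hs0 : 0 < s := ht₀0.trans hsI.1
    have hRs : 0 < R + s := by linarith
    refine le_trans ?_ (hs ⟨hs0, hsI.2⟩)
    rw [hHY, Real.mul_rpow (Real.exp_pos _).le (hH0.trans (hmono _ _ ht₀0.le hsI.1.le hsI.2.le)),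
      Real.mul_rpow (Real.exp_pos _).le (by positivity), ← Real.rpow_mul hRs.le]
    have e1 : Real.exp (l * s) ^ p * Real.exp (l * s) ^ (1 - p) = Real.exp (l * s) := by
      rw [← Real.rpow_add (Real.exp_pos _)]; simp
    have e2 : ν * (1 - p) = -(ν * (p - 1)) := by ring
    have hle : h ^ p ≤ H s ^ p :=
      Real.rpow_le_rpow hH0 (hmono _ _ ht₀0.le hsI.1.le hsI.2.le) (by linarith)
    calc c₁ * Real.exp (l * s) * h ^ p * (R + s) ^ (-(ν * (p - 1)))
        ≤ c₁ * Real.exp (l * s) * H s ^ p * (R + s) ^ (-(ν * (p - 1))) := by gcongr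
      _ = _ := by rw [e2]; nth_rewrite 1 [← e1]; ring
  -- Only the window [t − τ, t] of the convolution is kept. It lies after t₀, where H ≥ h, and its
  -- length supplies the factor τ.
  have hY : ∀ t, t₀ + τ ≤ t → t ≤ B →
      c₁ * Real.exp (-3 * l) * τ * Real.exp (l * t) * h ^ p * (R + t) ^ (-(ν * (p - 1))) ≤
        expPrimitive (-2 * l) 0 M t := by
    intro t ht htB
    have htτ : 0 ≤ t - τ := by linarith
    have hRt : 0 < R + t := by linarith
    have hii : ∀ x y : ℝ, 0 ≤ x → x ≤ y → y ≤ B →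
        IntervalIntegrable (fun s => Real.exp (-2 * l * (t - s)) * M s) volume x y :=
      fun x y hx hxy hy =>
        IntervalIntegrable.continuousOn_mul ((intervalIntegrable_iff_integrableOn_Ioc_of_le hxy).2
          (hMi.mono_set (Ioc_subset_Ioc hx hy))) (by fun_prop)
    rw [expPrimitive_eq, mul_zero, zero_add, ← intervalIntegral.integral_add_adjacent_intervals
      (hii 0 (t - τ) le_rfl htτ (by linarith)) (hii (t - τ) t htτ (by linarith) htB)]
    have n1 : 0 ≤ ∫ s in (0:ℝ)..(t - τ), Real.exp (-2 * l * (t - s)) * M s :=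
      intervalIntegral.integral_nonneg htτ fun s _ => mul_nonneg (Real.exp_pos _).le (hM0 s)
    have n2 : ∫ s in (t - τ)..t, c₁ * Real.exp (-3 * l) * Real.exp (l * t) * h ^ p *
        (R + t) ^ (-(ν * (p - 1))) ≤ ∫ s in (t - τ)..t, Real.exp (-2 * l * (t - s)) * M s := by
      refine intervalIntegral.integral_mono_ae_restrict (by linarith) (by simp)
        (hii (t - τ) t htτ (by linarith) htB) ?_
      rw [Filter.EventuallyLE, ae_restrict_iff' measurableSet_Icc]
      have hne : ∀ᵐ s : ℝ, s ≠ t - τ ∧ s ≠ t :=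
        (Measure.ae_ne volume (t - τ)).and (Measure.ae_ne volume t)
      filter_upwards [hM', hne] with s hs hne hsI
      have hs1 : t - τ < s := lt_of_le_of_ne hsI.1 (Ne.symm hne.1)
      have hs2 : s < t := lt_of_le_of_ne hsI.2 hne.2
      have hRs : 0 < R + s := by linarith
      have hs' := hs ⟨by linarith, by linarith⟩
      -- The right side is e^{lt − 3l(t−s)}, and t − s ≤ τ ≤ 1.
      have e1 : Real.exp (-3 * l) * Real.exp (l * t) ≤
          Real.exp (-2 * l * (t - s)) * Real.exp (l * s) := by
        rw [← Real.exp_add, ← Real.exp_add, Real.exp_le_exp]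
        nlinarith
      have e2 : (R + t) ^ (-(ν * (p - 1))) ≤ (R + s) ^ (-(ν * (p - 1))) :=
        Real.rpow_le_rpow_of_nonpos hRs (by linarith)
          (by have := mul_nonneg hν (by linarith : 0 ≤ p - 1); linarith)
      calc c₁ * Real.exp (-3 * l) * Real.exp (l * t) * h ^ p * (R + t) ^ (-(ν * (p - 1)))
          = c₁ * (Real.exp (-3 * l) * Real.exp (l * t)) * h ^ p *
              (R + t) ^ (-(ν * (p - 1))) := by ring
        _ ≤ c₁ * (Real.exp (-2 * l * (t - s)) * Real.exp (l * s)) * h ^ p *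
              (R + s) ^ (-(ν * (p - 1))) := by gcongr
        _ = Real.exp (-2 * l * (t - s)) *
              (c₁ * Real.exp (l * s) * h ^ p * (R + s) ^ (-(ν * (p - 1)))) := by ring
        _ ≤ _ := by gcongr
    rw [intervalIntegral.integral_const, smul_eq_mul] at n2
    have e3 : (t - (t - τ)) * (c₁ * Real.exp (-3 * l) * Real.exp (l * t) * h ^ p *
        (R + t) ^ (-(ν * (p - 1)))) = c₁ * Real.exp (-3 * l) * τ * Real.exp (l * t) * h ^ p *
        (R + t) ^ (-(ν * (p - 1))) := by ring
    linarith
  set C := (c₁ * Real.exp (-3 * l)) ^ q * c₃ with hC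
  have hC0 : 0 < C := by positivity
  -- The powers of e^{lt} cancel completely, and the powers of R + t add up to ν(1 − q) − ν(p − 1)q
  -- = −κ.
  have hN' : ∀ᵐ t, t ∈ Ioo (t₀ + τ) B →
      C * τ ^ q * h ^ (p * q) * (R + t) ^ (-κ) ≤ Real.exp (-l * t) * N t := by
    filter_upwards [hN] with t ht htI
    have hRt : 0 < R + t := by linarith [htI.1]
    have k := ht ⟨by linarith [htI.1], htI.2⟩ _ (by positivity) (hY t htI.1.le htI.2.le)
    have hee : Real.exp (-l * t) * Real.exp (l * t) = 1 := by rw [← Real.exp_add]; simp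
    have e1 : Real.exp (l * t) ^ q * Real.exp (l * t) ^ (1 - q) = Real.exp (l * t) := by
      rw [← Real.rpow_add (Real.exp_pos _)]; simp
    have e2 : (R + t) ^ (-(ν * (p - 1)) * q) * (R + t) ^ (ν * (1 - q)) = (R + t) ^ (-κ) := by
      rw [← Real.rpow_add hRt]; congr 1; rw [hκdef]; ring
    have e3 : (c₁ * Real.exp (-3 * l) * τ * Real.exp (l * t) * h ^ p *
        (R + t) ^ (-(ν * (p - 1)))) ^ q = (c₁ * Real.exp (-3 * l)) ^ q * τ ^ q *
        Real.exp (l * t) ^ q * h ^ (p * q) * (R + t) ^ (-(ν * (p - 1)) * q) := by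
      rw [Real.mul_rpow (by positivity) (by positivity),
        Real.mul_rpow (by positivity) (by positivity),
        Real.mul_rpow (by positivity) (by positivity),
        Real.mul_rpow (by positivity) (by positivity), ← Real.rpow_mul hH0,
        ← Real.rpow_mul hRt.le]
    rw [e3, Real.mul_rpow (Real.exp_pos _).le (by positivity), ← Real.rpow_mul hRt.le] at k
    have k' := mul_le_mul_of_nonneg_left k (Real.exp_pos (-l * t)).le
    refine le_trans (le_of_eq ?_) k'
    rw [← e2, hC]
    generalize (R + t) ^ (-(ν * (p - 1)) * q) = X
    generalize (R + t) ^ (ν * (1 - q)) = Y at *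
    calc (c₁ * Real.exp (-3 * l)) ^ q * c₃ * τ ^ q * h ^ (p * q) * (X * Y)
        = (c₁ * Real.exp (-3 * l)) ^ q * c₃ * τ ^ q * h ^ (p * q) * (X * Y) *
          (Real.exp (-l * t) * (Real.exp (l * t) ^ q * Real.exp (l * t) ^ (1 - q))) := by
            rw [e1, hee, mul_one]
      _ = _ := by ring
  -- As κ ≤ 1, t^{−κ} = t^{1−κ}/t is at least T₀^{1−κ}/t. This gives a logarithmic integral in both
  -- cases and keeps the subcritical gain as a power of T₀.
  have hpow : ∀ t, t₀ + τ ≤ t → (1 + R) ^ (-κ) * T₀ ^ (1 - κ) * t⁻¹ ≤ (R + t) ^ (-κ) := by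
    intro t ht
    have ht1 : 1 ≤ t := by linarith
    have ht0 : 0 < t := by linarith
    calc (1 + R) ^ (-κ) * T₀ ^ (1 - κ) * t⁻¹ ≤ (1 + R) ^ (-κ) * t ^ (1 - κ) * t⁻¹ := by
          have : T₀ ^ (1 - κ) ≤ t ^ (1 - κ) :=
            Real.rpow_le_rpow (by linarith) (by linarith) (by linarith)
          gcongr
      _ = ((1 + R) * t) ^ (-κ) := by
          rw [Real.mul_rpow (by linarith) ht0.le, mul_assoc, ← Real.rpow_neg_one t,
            ← Real.rpow_add ht0]
          congr 2; ring
      _ ≤ (R + t) ^ (-κ) :=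
          Real.rpow_le_rpow_of_nonpos (by linarith) (by nlinarith) (by linarith)
  have hτt : 0 < t₀ + τ := by linarith
  have hintegral : ∫ t in (t₀ + τ)..t₁, C * τ ^ q * h ^ (p * q) * ((1 + R) ^ (-κ) * T₀ ^ (1 - κ)) * t⁻¹ ≤
      ∫ t in (t₀ + τ)..t₁, Real.exp (-l * t) * N t := by
    refine intervalIntegral.integral_mono_ae_restrict ht₁ ?_ (hWii _ _ hτt.le ht₁ ht₁B) ?_
    · refine ContinuousOn.intervalIntegrable ?_
      rw [uIcc_of_le ht₁]
      refine continuousOn_const.mul (continuousOn_id.inv₀ fun t ht => ?_)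
      have := ht.1
      simp only [id]
      linarith
    · rw [Filter.EventuallyLE, ae_restrict_iff' measurableSet_Icc]
      have hne : ∀ᵐ s : ℝ, s ≠ t₀ + τ ∧ s ≠ t₁ :=
        (Measure.ae_ne volume (t₀ + τ)).and (Measure.ae_ne volume t₁)
      filter_upwards [hN', hne] with t ht hne htI
      refine le_trans ?_ (ht ⟨lt_of_le_of_ne htI.1 (Ne.symm hne.1),
        lt_of_lt_of_le (lt_of_le_of_ne htI.2 hne.2) ht₁B⟩)
      rw [mul_assoc]
      exact mul_le_mul_of_nonneg_left (hpow t htI.1) (by positivity)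
  rw [intervalIntegral.integral_const_mul, integral_inv_of_pos hτt (by linarith)] at hintegral
  have d1 := hdiff (t₀ + τ) t₁ hτt.le ht₁ ht₁B
  have d2 := hmono t₀ (t₀ + τ) ht₀0.le (by linarith) (by linarith)
  change h + C * (1 + R) ^ (-κ) / 2 * τ ^ q * h ^ (p * q) * T₀ ^ (1 - κ) *
    Real.log (t₁ / (t₀ + τ)) ≤ H t₁
  have e : C * (1 + R) ^ (-κ) / 2 * τ ^ q * h ^ (p * q) * T₀ ^ (1 - κ) *
    Real.log (t₁ / (t₀ + τ)) = (C * τ ^ q * h ^ (p * q) * ((1 + R) ^ (-κ) * T₀ ^ (1 - κ)) *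
    Real.log (t₁ / (t₀ + τ))) / 2 := by ring
  rw [e]
  linarith

/-! ### Lifespan bound with two free parameters -/

/-- Upper bound for the lifespan in terms of two free parameters `T₀` and `L`. -/
theorem exists_lifespan_le {n : ℕ} (hn : 1 ≤ n) (a : Fin n) {b p q R : ℝ} (hb : 0 < b)
    (hp : 1 < p) (hq : 1 < q) (hR : 0 < R) (hκ : ((n : ℝ) - 1) / 2 * (p * q - 1) ≤ 1) :
    ∃ c : ℝ, 0 < c ∧ ∀ (m : ℝ) (f₀ f₁ g₀ g₁ : Space n → ℝ), 4 * m ^ 2 ≤ b ^ 2 →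
      Continuous f₀ → Continuous f₁ → Continuous g₀ → Continuous g₁ →
      (∀ x, 0 ≤ f₀ x) → (∀ x, 0 ≤ f₁ x) → (∀ x, 0 ≤ g₀ x) → (∀ x, 0 ≤ g₁ x) →
      tsupport f₀ ⊆ Metric.closedBall 0 R → tsupport f₁ ⊆ Metric.closedBall 0 R →
      tsupport g₀ ⊆ Metric.closedBall 0 R → tsupport g₁ ⊆ Metric.closedBall 0 R →
      0 < ∫ x, g₁ x * planeExp a b x →
      ∀ (T : EReal) (u v : ℝ × Space n → ℝ), IsSolution n b m p q f₀ f₁ g₀ g₁ T u v →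
        SupportedInCone n R T u → SupportedInCone n R T v →
        ∀ T₀ L : ℝ, 1 ≤ T₀ → 1 ≤ L →
          1 ≤ c * L * T₀ ^ (1 - ((n : ℝ) - 1) / 2 * (p * q - 1)) *
            ((∫ x, g₁ x * planeExp a b x) / 2) ^ (p * q - 1) →
          T ≤ ((T₀ * Real.exp (2 * L *
            (1 - (2 : ℝ) ^ (-((p * q - 1) / (q + 1))))⁻¹) : ℝ) : EReal) := by
  obtain ⟨C₀, hC₀, hC₀le⟩ := exists_setIntegral_exp_le hn a hb
  set ν := ((n : ℝ) - 1) / 2 with hνdef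
  have hν : 0 ≤ ν := by
    have : (1 : ℝ) ≤ n := by exact_mod_cast hn
    rw [hνdef]; linarith
  have hpq : 1 < p * q := by nlinarith
  set D := C₀ * Real.exp (b * R) with hD
  have hD0 : 0 < D := by positivity
  -- The constant of `add_rpow_mul_log_le` with c₁ = D^{1−p} and c₃ = D^{1−q}; it is fixed before m
  -- and the data.
  refine ⟨(D ^ (1 - p) * Real.exp (-3 * b)) ^ q * D ^ (1 - q) *
    (1 + R) ^ (-(ν * (p * q - 1))) / 2, by positivity, ?_⟩
  intro m f₀ f₁ g₀ g₁ hm hf₀c hf₁c hg₀c hg₁c hf₀ hf₁ hg₀ hg₁ hf₀s hf₁s hg₀s hg₁s hJ T u v hsol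
    hu hv T₀ L hT₀ hL hcond
  obtain ⟨ut, vt, hut, hvt, huq, hvp, hsu, hsv⟩ := hsol.system
  -- If the solution lived beyond the bound B, everything would be integrable on [0, B], and the
  -- slicing argument up to time B would give B < B.
  by_contra! hBT
  set B := T₀ * Real.exp (2 * L * (1 - (2 : ℝ) ^ (-((p * q - 1) / (q + 1))))⁻¹) with hBdef
  have hB : 0 < B := by positivity
  set J := ∫ x, g₁ x * planeExp a b x with hJdef
  set M := expMean a b (R + B) (fun z => |vt z| ^ p) with hMdef
  set N := expMean a b (R + B) (fun z => |ut z| ^ q) with hNdef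
  have hM0 : ∀ t, 0 ≤ M t := expMean_nonneg a b _ fun z => by positivity
  have hN0 : ∀ t, 0 ≤ N t := expMean_nonneg a b _ fun z => by positivity
  have hcomp := isCompact_Icc (a := (0:ℝ)) (b := B) |>.prod
    (isCompact_closedBall (0 : Space n) (R + B))
  have hMi : IntegrableOn M (Ioc 0 B) := integrableOn_expMean a b
    (hvp.integrableOn_compact_subset (Icc_prod_subset_slab hBT _) hcomp)
  have hNi : IntegrableOn N (Ioc 0 B) := integrableOn_expMean a b
    (huq.integrableOn_compact_subset (Icc_prod_subset_slab hBT _) hcomp)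
  have hvp0 : ∀ᵐ z : ℝ × Space n, z.1 ∈ Ioo 0 B → R + z.1 < ‖z.2‖ → |vt z| ^ p = 0 := by
    filter_upwards [hvt.ae_eq_zero hBT hv] with z hz h1 h2
    rw [hz h1 h2, abs_zero, Real.zero_rpow (by linarith)]
  have huq0 : ∀ᵐ z : ℝ × Space n, z.1 ∈ Ioo 0 B → R + z.1 < ‖z.2‖ → |ut z| ^ q = 0 := by
    filter_upwards [hut.ae_eq_zero hBT hu] with z hz h1 h2
    rw [hz h1 h2, abs_zero, Real.zero_rpow (by linarith)]
  have hlu := hsu.ae_expPrimitive_le_expMean_of_damped a hb hm hR hB hBT hsol.continuous_u hu hut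
    hvp hvp0 (fun z => by positivity) hf₀c hf₁c hf₀s hf₁s hf₀ hf₁
  have hlv := hsv.ae_expPrimitive_le_expMean_of_wave a hb hR hB hBT hsol.continuous_v hv hvt
    huq huq0 (fun z => by positivity) hg₀c hg₁c hg₀s hg₁s hg₀ hg₁
  have hjv := hvt.ae_rpow_le_expMean a b (B := B) hp hBT hv hvp
  have hju := hut.ae_rpow_le_expMean a b (B := B) hq hBT hu huq
  have hA : ∀ t, 0 < t → ∫ x in Metric.closedBall (0 : Space n) (R + t), planeExp a b x ≤
      D * (Real.exp (b * t) * (R + t) ^ ν) := by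
    intro t ht
    refine (hC₀le (R + t) (by linarith)).trans (le_of_eq ?_)
    rw [mul_add, Real.exp_add, hD]
    ring
  have hApos : ∀ t, 0 < t → 0 < Real.exp (b * t) * (R + t) ^ ν := fun t ht => by
    have : 0 < R + t := by linarith
    positivity
  have hM : ∀ᵐ t, t ∈ Ioo 0 B → (expPrimitive b J N t / 2) ^ p *
      (D ^ (1 - p) * (Real.exp (b * t) * (R + t) ^ ν) ^ (1 - p)) ≤ M t := by
    filter_upwards [hjv, hlv] with t h1 h2 ht
    have h := h1 ht _ _ (div_nonneg (expPrimitive_nonneg hJ.le hN0 ht.1.le) zero_le_two) (h2 ht)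
      (mul_pos hD0 (hApos t ht.1)) (hA t ht.1)
    rwa [Real.mul_rpow hD0.le (hApos t ht.1).le] at h
  have hN : ∀ᵐ t, t ∈ Ioo 0 B → ∀ y : ℝ, 0 ≤ y → y ≤ expPrimitive (-2 * b) 0 M t →
      y ^ q * (D ^ (1 - q) * (Real.exp (b * t) * (R + t) ^ ν) ^ (1 - q)) ≤ N t := by
    filter_upwards [hju, hlu] with t h1 h2 ht y hy hyle
    have h := h1 ht y _ hy (hyle.trans (h2 ht)) (mul_pos hD0 (hApos t ht.1)) (hA t ht.1)
    rwa [Real.mul_rpow hD0.le (hApos t ht.1).le] at h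
  have hWi : IntegrableOn (fun s => Real.exp (-b * s) * N s) (Ioc 0 B) :=
    (((integrableOn_Icc_iff_integrableOn_Ioc).2 hNi).continuousOn_mul (by fun_prop)
      isCompact_Icc).mono_set Ioc_subset_Icc_self
  have hW0 : ∀ s, 0 ≤ Real.exp (-b * s) * N s := fun s => mul_nonneg (Real.exp_pos _).le (hN0 s)
  refine lt_irrefl B (lt_of_log_slicing
    (H := fun t => (J + ∫ s in (0 : ℝ)..t, Real.exp (-b * s) * N s) / 2) (h₀ := J / 2)
    hpq hq (by positivity) (Real.rpow_pos_of_pos (by linarith) _) (by linarith) hT₀ hL ?_ ?_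
    (fun t₀ t₁ τ h1 h2 h3 h4 h5 => add_rpow_mul_log_le hp hq hb hR hν hκ (by positivity)
      (by positivity) hJ.le hM0 hN0 hMi hNi hM hN hT₀ h1 h2 h3 h4 h5) hcond)
  · intro x hx y hy hxy
    have hx0 : 0 ≤ x := by linarith [hx.1]
    have : ∫ s in (0 : ℝ)..x, Real.exp (-b * s) * N s ≤
        ∫ s in (0 : ℝ)..y, Real.exp (-b * s) * N s := by
      rw [intervalIntegral.integral_of_le hx0, intervalIntegral.integral_of_le (hx0.trans hxy)]
      exact setIntegral_mono_set (hWi.mono_set (Ioc_subset_Ioc_right hy.2))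
        (Filter.Eventually.of_forall hW0) (Ioc_subset_Ioc_right hxy).eventuallyLE
    simp only
    linarith
  · intro _
    have : 0 ≤ ∫ s in (0 : ℝ)..T₀, Real.exp (-b * s) * N s :=
      intervalIntegral.integral_nonneg (by linarith) fun s _ => hW0 s
    linarith

/-- Nontriviality of the initial velocity of v enters here: it provides the positive starting value
of H. -/
theorem integral_mul_planeExp_pos {n : ℕ} (a : Fin n) (l : ℝ) {R : ℝ} {g : Space n → ℝ}
    (hg : Continuous g) (hgn : ∀ x, 0 ≤ g x) (hgs : tsupport g ⊆ Metric.closedBall 0 R)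
    (hg0 : g ≠ 0) : 0 < ∫ x, g x * planeExp a l x := by
  obtain ⟨x, hx⟩ := Function.ne_iff.1 hg0
  refine Continuous.integral_pos_of_hasCompactSupport_nonneg_nonzero (x := x)
    (hg.mul (continuous_planeExp a l)) ?_ (fun y => mul_nonneg (hgn y) (planeExp_pos a l y).le)
    (mul_ne_zero hx (planeExp_pos a l x).ne')
  exact HasCompactSupport.mul_right
    ((isCompact_closedBall _ _).of_isClosed_subset (isClosed_tsupport g) hgs)

end Nakao

/-! ### Choice of the parameters in the two cases -/

theorem theorem1 (n : ℕ) (hn : 1 ≤ n) (b p q R : ℝ) (hb : 0 < b) (hp : 1 < p) (hq : 1 < q)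
    (hR : 0 < R) (hθ : 0 ≤ Nakao.theta n p q)
    (v₁ : Nakao.Space n → ℝ) (hv₁ : ContDiff ℝ 1 v₁) (hv₁_nonneg : ∀ x, 0 ≤ v₁ x)
    (hv₁_supp : tsupport v₁ ⊆ Metric.closedBall 0 R) (hv₁_ne : v₁ ≠ 0) :
    ∃ ε₀ C : ℝ, 0 < ε₀ ∧ 0 < C ∧
      ∀ (m : ℝ) (u₀ u₁ v₀ : Nakao.Space n → ℝ), 4 * m ^ 2 ≤ b ^ 2 →
        ContDiff ℝ 2 u₀ → ContDiff ℝ 1 u₁ → ContDiff ℝ 2 v₀ →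
        (∀ x, 0 ≤ u₀ x) → (∀ x, 0 ≤ u₁ x) → (∀ x, 0 ≤ v₀ x) →
        tsupport u₀ ⊆ Metric.closedBall 0 R → tsupport u₁ ⊆ Metric.closedBall 0 R →
        tsupport v₀ ⊆ Metric.closedBall 0 R →
        ∀ ε : ℝ, 0 < ε → ε ≤ ε₀ →
          ∀ (T : EReal) (u v : ℝ × Nakao.Space n → ℝ), 0 < T →
            Nakao.IsSolution n b m p q (fun x => ε * u₀ x) (fun x => ε * u₁ x)
              (fun x => ε * v₀ x) (fun x => ε * v₁ x) T u v →
            Nakao.SupportedInCone n R T u → Nakao.SupportedInCone n R T v →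
            T < ⊤ ∧
            (0 < Nakao.theta n p q →
              T ≤ ((C * ε ^ (-(1 / Nakao.theta n p q)) : ℝ) : EReal)) ∧
            (Nakao.theta n p q = 0 →
              T ≤ ((Real.exp (C * ε ^ (-(p * q - 1))) : ℝ) : EReal)) := by
  have hpq : 1 < p * q := by nlinarith
  have hP : 0 < p * q - 1 := by linarith
  set θ := Nakao.theta n p q with hθdef
  -- The gain exponent 1 − κ is (pq − 1)θ, so θ = 0 is the case without any gain from T₀.
  have hκθ : 1 - ((n : ℝ) - 1) / 2 * (p * q - 1) = (p * q - 1) * θ := by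
    rw [hθdef, Nakao.theta]; field_simp
  have hκ : ((n : ℝ) - 1) / 2 * (p * q - 1) ≤ 1 := by
    have := mul_nonneg hP.le hθ
    linarith
  let a : Fin n := ⟨0, hn⟩
  obtain ⟨c, hc, hlife⟩ := Nakao.exists_lifespan_le hn a hb hp hq hR hκ
  rw [hκθ] at hlife
  set I := ∫ x, v₁ x * Nakao.planeExp a b x with hI
  have hIpos : 0 < I :=
    Nakao.integral_mul_planeExp_pos a b hv₁.continuous hv₁_nonneg hv₁_supp hv₁_ne
  set S := (1 - (2 : ℝ) ^ (-((p * q - 1) / (q + 1))))⁻¹ with hS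
  have hS0 : 0 < S := by
    rw [hS, inv_pos, sub_pos]
    exact Real.rpow_lt_one_of_one_lt_of_neg (by norm_num)
      (neg_neg_of_pos (div_pos hP (by linarith)))
  set k := c * (I / 2) ^ (p * q - 1) with hk
  have hk0 : 0 < k := by positivity
  have hlife' : ∀ (m : ℝ) (u₀ u₁ v₀ : Nakao.Space n → ℝ), 4 * m ^ 2 ≤ b ^ 2 →
        ContDiff ℝ 2 u₀ → ContDiff ℝ 1 u₁ → ContDiff ℝ 2 v₀ →
        (∀ x, 0 ≤ u₀ x) → (∀ x, 0 ≤ u₁ x) → (∀ x, 0 ≤ v₀ x) →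
        tsupport u₀ ⊆ Metric.closedBall 0 R → tsupport u₁ ⊆ Metric.closedBall 0 R →
        tsupport v₀ ⊆ Metric.closedBall 0 R →
        ∀ ε : ℝ, 0 < ε →
          ∀ (T : EReal) (u v : ℝ × Nakao.Space n → ℝ),
            Nakao.IsSolution n b m p q (fun x => ε * u₀ x) (fun x => ε * u₁ x)
              (fun x => ε * v₀ x) (fun x => ε * v₁ x) T u v →
            Nakao.SupportedInCone n R T u → Nakao.SupportedInCone n R T v →
            ∀ T₀ L : ℝ, 1 ≤ T₀ → 1 ≤ L →
              1 ≤ k * L * T₀ ^ ((p * q - 1) * θ) * ε ^ (p * q - 1) →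
              T ≤ ((T₀ * Real.exp (2 * L * S) : ℝ) : EReal) := by
    intro m u₀ u₁ v₀ hm hu₀ hu₁ hv₀ hu₀n hu₁n hv₀n hu₀s hu₁s hv₀s ε hε T u v hsol hu hv T₀ L
      hT₀ hL hcond
    have hsupp : ∀ g : Nakao.Space n → ℝ, tsupport g ⊆ Metric.closedBall 0 R →
        tsupport (fun x => ε * g x) ⊆ Metric.closedBall 0 R := fun g hg =>
      (tsupport_mul_subset_right (f := fun _ => ε)).trans hg
    have hJ : ∫ x, ε * v₁ x * Nakao.planeExp a b x = ε * I := by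
      simp only [mul_assoc, hI, integral_const_mul]
    refine hlife m _ _ _ _ hm (hu₀.continuous.const_mul ε) (hu₁.continuous.const_mul ε)
      (hv₀.continuous.const_mul ε) (hv₁.continuous.const_mul ε)
      (fun x => mul_nonneg hε.le (hu₀n x)) (fun x => mul_nonneg hε.le (hu₁n x))
      (fun x => mul_nonneg hε.le (hv₀n x)) (fun x => mul_nonneg hε.le (hv₁_nonneg x))
      (hsupp _ hu₀s) (hsupp _ hu₁s) (hsupp _ hv₀s) (hsupp _ hv₁_supp)
      (by rw [hJ]; positivity) T u v hsol hu hv T₀ L hT₀ hL (hcond.trans (le_of_eq ?_))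
    rw [hJ, mul_div_assoc, Real.mul_rpow hε.le (by positivity), hk]
    ring
  rcases hθ.eq_or_lt with hθ0 | hθpos
  -- Critical case: T₀ = 1, and L = A ε^{−(pq−1)} compensates ε^{pq−1}. The bound ε ≤ 1 serves only
  -- to ensure L ≥ 1.
  · set A := max 1 k⁻¹ with hA
    have hA1 : 1 ≤ A := le_max_left _ _
    have hAk : 1 ≤ k * A := by
      have := mul_le_mul_of_nonneg_left (le_max_right 1 k⁻¹) hk0.le
      rwa [mul_inv_cancel₀ hk0.ne'] at this
    refine ⟨1, 2 * A * S, one_pos, by positivity, ?_⟩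
    intro m u₀ u₁ v₀ hm hu₀ hu₁ hv₀ hu₀n hu₁n hv₀n hu₀s hu₁s hv₀s ε hε hε1 T u v _ hsol hu hv
    have hεP : 1 ≤ ε ^ (-(p * q - 1)) :=
      Real.one_le_rpow_of_pos_of_le_one_of_nonpos hε hε1 (by linarith)
    have key := hlife' m u₀ u₁ v₀ hm hu₀ hu₁ hv₀ hu₀n hu₁n hv₀n hu₀s hu₁s hv₀s ε hε T u v hsol
      hu hv 1 (A * ε ^ (-(p * q - 1))) le_rfl (by nlinarith) (by
        rw [Real.one_rpow, mul_one, ← mul_assoc, mul_assoc (k * A), ← Real.rpow_add hε]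
        simpa using hAk)
    have e : 1 * Real.exp (2 * (A * ε ^ (-(p * q - 1))) * S) =
        Real.exp (2 * A * S * ε ^ (-(p * q - 1))) := by
      rw [one_mul]; congr 1; ring
    rw [e] at key
    exact ⟨lt_of_le_of_lt key (EReal.coe_lt_top _), fun h => absurd h (by linarith), fun _ => key⟩
  -- Subcritical case: L = 1, and T₀ = A ε^{−1/θ}, because T₀^{(pq−1)θ} then compensates ε^{pq−1}.
  -- Here ε ≤ 1 ensures T₀ ≥ 1.
  · set A := max 1 ((k⁻¹) ^ (((p * q - 1) * θ)⁻¹)) with hA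
    have hPθ : 0 < (p * q - 1) * θ := mul_pos hP hθpos
    have hA1 : 1 ≤ A := le_max_left _ _
    have hAk : 1 ≤ k * A ^ ((p * q - 1) * θ) := by
      have h1 : k⁻¹ ≤ A ^ ((p * q - 1) * θ) := by
        have := Real.rpow_le_rpow (by positivity) (le_max_right 1 ((k⁻¹) ^ (((p * q - 1) * θ)⁻¹)))
          hPθ.le
        rwa [Real.rpow_inv_rpow (by positivity) hPθ.ne'] at this
      have := mul_le_mul_of_nonneg_left h1 hk0.le
      rwa [mul_inv_cancel₀ hk0.ne'] at this
    refine ⟨1, A * Real.exp (2 * S), one_pos, by positivity, ?_⟩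
    intro m u₀ u₁ v₀ hm hu₀ hu₁ hv₀ hu₀n hu₁n hv₀n hu₀s hu₁s hv₀s ε hε hε1 T u v _ hsol hu hv
    have hεθ : 1 ≤ ε ^ (-(1 / θ)) :=
      Real.one_le_rpow_of_pos_of_le_one_of_nonpos hε hε1
        (neg_nonpos.2 (one_div_pos.2 hθpos).le)
    have key := hlife' m u₀ u₁ v₀ hm hu₀ hu₁ hv₀ hu₀n hu₁n hv₀n hu₀s hu₁s hv₀s ε hε T u v hsol
      hu hv (A * ε ^ (-(1 / θ))) 1 (by nlinarith) le_rfl (by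
        have e : -(1 / θ) * ((p * q - 1) * θ) + (p * q - 1) = 0 := by field_simp; ring
        rw [Real.mul_rpow (by linarith) (by positivity), ← Real.rpow_mul hε.le, mul_one,
          ← mul_assoc, mul_assoc (k * A ^ ((p * q - 1) * θ)), ← Real.rpow_add hε, e,
          Real.rpow_zero, mul_one]
        exact hAk)
    have e : A * ε ^ (-(1 / θ)) * Real.exp (2 * 1 * S) =
        A * Real.exp (2 * S) * ε ^ (-(1 / θ)) := by
      rw [mul_one]; ring
    rw [e] at key
    exact ⟨lt_of_le_of_lt key (EReal.coe_lt_top _), fun _ => key, fun h => absurd h hθpos.ne'⟩
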